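/- Let $d\ge 1$ be an odd integer, let $\delta\in[0,1]$, and let $\mathcal D_\delta(\rho)=(1-\delta)\rho+\delta\,\mathrm{tr}(\rho)\,I/d$ be the depolarizing channel on $\mathbb C^d$. **Discrete Wigner functions.** For odd $m$ let $X|j\rangle=|j+1\rangle$ and $Z|j\rangle=e^{2\pi i j/m}|j\rangle$ on $\mathbb C^m$ ($j\in\mathbb Z_m$), $\tau=e^{(m+1)\pi i/m}$, $T_{(a_1,a_2)}=\tau^{-a_1a_2}Z^{a_1}X^{a_2}$, $A^{\mathbf 0}=\frac1m\sum_{\mathbf u\in\mathbb Z_m^2}T_{\mathbf u}$ and $A^{\mathbf u}=T_{\mathbf u}A^{\mathbf 0}T_{\mathbf u}^\dagger$; on composite systems phase-space point operators are tensor products of those of the subsystems. The discrete Wigner function of a Hermitian operator $\rho$ on a system of total dimension $D$ is $W_\rho(\mathbf u)=\frac1D\mathrm{tr}[A^{\mathbf u}\rho]$. **Protocols.** Let $\mathcal A$ be the set of linear maps $\mathcal E$ from operators on $(\mathbb C^d)^{\otimes 2}$ to operators on $\mathbb C^d$ that are completely positive, trace non-increasing, and completely positive Wigner preserving (CPWP):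 for every reference system $R$ composed of finitely many odd-dimensional subsystems and every density operator $\rho$ on $R\otimes(\mathbb C^d)^{\otimes 2}$ with $W_\rho\ge 0$, the (possibly unnormalized) operator $(\mathrm{id}_R\otimes\mathcal E)(\rho)$ is positive semidefinite with non-negative discrete Wigner function. For a unit vector $|\psi\rangle\in\mathbb C^d$ put $\psi=|\psi\rangle\langle\psi|$ and $\sigma_\psi=\mathcal E(\mathcal D_\delta(\psi)^{\otimes 2})$, and let $d\psi$ be the Haar probability measure on pure states. For $p\in(0,1]$ the maximal non-magic universal purification fidelity is $$F(2,p)=\max\Big\{\tfrac1p\int \mathrm{tr}[\sigma_\psi\,\psi]\,d\psi \;:\; \mathcal E\in\mathcal A,\ \int \mathrm{tr}[\sigma_\psi]\,d\psi=p\Big\}.$$ **Theorem (no two-to-one universal probabilistic purification by CPWP operations).** 1. The average fidelity without purification is $\int \mathrm{tr}[\mathcal D_\delta(\psi)\psi]\,d\psi = 1-\frac{d-1}{d}\delta$. 2. No protocol in $\mathcal A$ purifies: for every $\mathcal E\in\mathcal A$ with $\int\mathrm{tr}[\sigma_\psi]\,d\psi>0$, $$\frac{\int \mathrm{tr}[\sigma_\psi\,\psi]\,d\psi}{\int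 \mathrm{tr}[\sigma_\psi]\,d\psi}\;\le\;\int \mathrm{tr}[\mathcal D_\delta(\psi)\psi]\,d\psi .$$ 3. For every $p\in(0,1]$ the maximum defining $F(2,p)$ is attained and $F(2,p)=1-\frac{d-1}{d}\delta$. -/

import Mathlib

open MeasureTheory
open scoped Kronecker ComplexOrder

noncomputable section

namespace Purification

/-! ### Heisenberg-Weyl operators and phase-space point operators -/

/-- The shift operator `X|j⟩ = |j+1⟩` on `ℂ^d`, with computational basis indexed by `ℤ_d`. -/
def shiftOp (d : ℕ) : Matrix (ZMod d) (ZMod d) ℂ :=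
  Matrix.of fun i j => if i = j + 1 then 1 else 0

/-- The boost operator `Z|j⟩ = w^j |j⟩` with `w = exp(2πi/d)`. -/
def boostOp (d : ℕ) : Matrix (ZMod d) (ZMod d) ℂ :=
  Matrix.diagonal fun j => Complex.exp (2 * Real.pi * Complex.I / d) ^ j.val

/-- The phase `τ = exp((d+1)πi/d)`; for odd `d` it satisfies `τ^d = 1`. -/
def tau (d : ℕ) : ℂ := Complex.exp ((d + 1) * Real.pi * Complex.I / d)

/-- The Heisenberg-Weyl operator `T_u = τ^{-a₁a₂} Z^{a₁} X^{a₂}`, `u = (a₁, a₂) ∈ ℤ_d × ℤ_d`. -/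
def heisenbergWeyl (d : ℕ) [NeZero d] (u : ZMod d × ZMod d) : Matrix (ZMod d) (ZMod d) ℂ :=
  (tau d ^ (-((u.1.val : ℤ) * (u.2.val : ℤ)))) • (boostOp d ^ u.1.val * shiftOp d ^ u.2.val)

/-- The phase-space point operator at the origin, `A^0 = (1/d) ∑_u T_u`. -/
def pointOpZero (d : ℕ) [NeZero d] : Matrix (ZMod d) (ZMod d) ℂ :=
  ((d : ℂ)⁻¹) • ∑ u : ZMod d × ZMod d, heisenbergWeyl d u

/-- The phase-space point operator `A^u = T_u A^0 T_u†`. -/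
def pointOp (d : ℕ) [NeZero d] (u : ZMod d × ZMod d) : Matrix (ZMod d) (ZMod d) ℂ :=
  heisenbergWeyl d u * pointOpZero d * (heisenbergWeyl d u).conjTranspose

/-- The phase-space point operator of a composite system with subsystems of dimensions
`m 0, …, m (k-1)`: the tensor product of the phase-space point operators of the subsystems. -/
def pointOpPi {k : ℕ} (m : Fin k → ℕ) [∀ i, NeZero (m i)]
    (u : ∀ i, ZMod (m i) × ZMod (m i)) :
    Matrix (∀ i, ZMod (m i)) (∀ i, ZMod (m i)) ℂ :=
  Matrix.of fun x y => ∏ i, pointOp (m i) (u i) (x i) (y i)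

/-! ### Discrete Wigner functions -/

/-- The discrete Wigner function `W_ρ(u) = (1/D) tr[A^u ρ]` on a `D`-dimensional system with
phase-space point operators `A^u`.  The trace is real when `A^u` and `ρ` are Hermitian. -/
def wigner {α U : Type*} [Fintype α] (A : U → Matrix α α ℂ) (ρ : Matrix α α ℂ) (u : U) : ℝ :=
  ((Fintype.card α : ℂ)⁻¹ * (A u * ρ).trace).re

/-- Unnormalised states with non-negative discrete Wigner function. -/
def wignerCone {α U : Type*} [Fintype α] (A : U → Matrix α α ℂ) : Set (Matrix α α ℂ) :=
  {ρ | ρ.PosSemidef ∧ ∀ u, 0 ≤ wigner A ρ u}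

/-- The Wigner polytope `𝒲₊`: density operators with non-negative discrete Wigner function. -/
def wignerPolytope {α U : Type*} [Fintype α] (A : U → Matrix α α ℂ) : Set (Matrix α α ℂ) :=
  {ρ | ρ ∈ wignerCone A ∧ ρ.trace = 1}

/-- The phase-space point operators `A^{w ⊕ u} = A^w ⊗ A^u` of a bipartite system. -/
def pointOpProd {α β U V : Type*} (A : U → Matrix α α ℂ) (B : V → Matrix β β ℂ) :
    U × V → Matrix (α × β) (α × β) ℂ :=
  fun w => A w.1 ⊗ₖ B w.2

/-! ### Quantum operations -/

/-- The extension `id_R ⊗ E` of a linear map `E`, which acts by `E` on each block. -/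
def ampliate {α β : Type*} (R : Type*) (E : Matrix α α ℂ →ₗ[ℂ] Matrix β β ℂ)
    (M : Matrix (R × α) (R × α) ℂ) : Matrix (R × β) (R × β) ℂ :=
  Matrix.of fun x y => E (Matrix.of fun i j => M (x.1, i) (y.1, j)) x.2 y.2

/-- Completely positive and trace-non-increasing linear maps. -/
structure IsCPTN {α β : Type*} [Fintype α] [Fintype β]
    (E : Matrix α α ℂ →ₗ[ℂ] Matrix β β ℂ) : Prop where
  completelyPositive : ∀ (k : ℕ) (M : Matrix (Fin k × α) (Fin k × α) ℂ),
    M.PosSemidef → (ampliate (Fin k) E M).PosSemidef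
  trace_le : ∀ M : Matrix α α ℂ, M.PosSemidef → (E M).trace.re ≤ M.trace.re

/-- Completely positive Wigner-preserving maps from `n` copies of a `d`-dimensional system to one
copy: for every reference system `R` made of finitely many odd-dimensional subsystems, `id_R ⊗ E`
maps states with non-negative Wigner function to (in general unnormalised, since `E` need not
preserve the trace) states with non-negative Wigner function. -/
def IsCPWP (d n : ℕ) [NeZero d]
    (E : Matrix (Fin n → ZMod d) (Fin n → ZMod d) ℂ →ₗ[ℂ] Matrix (ZMod d) (ZMod d) ℂ) : Prop :=
  ∀ (k : ℕ) (m : Fin k → ℕ) [∀ i, NeZero (m i)], (∀ i, Odd (m i)) →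
    ∀ ρ ∈ wignerPolytope (pointOpProd (pointOpPi m) (pointOpPi fun _ : Fin n => d)),
      ampliate (∀ i, ZMod (m i)) E ρ ∈ wignerCone (pointOpProd (pointOpPi m) (pointOp d))

/-- The non-magic purification protocols: CPWP operations that are CPTN. -/
def nonMagicProtocols (d n : ℕ) [NeZero d] :
    Set (Matrix (Fin n → ZMod d) (Fin n → ZMod d) ℂ →ₗ[ℂ] Matrix (ZMod d) (ZMod d) ℂ) :=
  {E | IsCPTN E ∧ IsCPWP d n E}

/-! ### Noisy pure states and the Haar average -/

/-- The depolarizing channel `D_δ(ρ) = (1-δ) ρ + δ tr(ρ) I/d`. -/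
def depolarize (d : ℕ) [NeZero d] (δ : ℝ) (ρ : Matrix (ZMod d) (ZMod d) ℂ) :
    Matrix (ZMod d) (ZMod d) ℂ :=
  ((1 - δ : ℝ) : ℂ) • ρ + ((δ : ℂ) * ρ.trace / d) • 1

/-- The `n`-fold tensor power `ρ^{⊗n}`. -/
def tensorPow {d : ℕ} (n : ℕ) (ρ : Matrix (ZMod d) (ZMod d) ℂ) :
    Matrix (Fin n → ZMod d) (Fin n → ZMod d) ℂ :=
  Matrix.of fun x y => ∏ i, ρ (x i) (y i)

/-- Unit vectors of `ℂ^d`. -/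
abbrev UnitVec (d : ℕ) [NeZero d] : Type :=
  Metric.sphere (0 : EuclideanSpace ℂ (ZMod d)) 1

/-- The density matrix `|ψ⟩⟨ψ|` of a unit vector. -/
def pureState {d : ℕ} [NeZero d] (ψ : UnitVec d) : Matrix (ZMod d) (ZMod d) ℂ :=
  Matrix.of fun i j => (ψ : EuclideanSpace ℂ (ZMod d)) i *
    star ((ψ : EuclideanSpace ℂ (ZMod d)) j)

/-- The Haar probability measure on pure states: the normalised surface measure of the unit
sphere of `ℂ^d`. -/
def haarState (d : ℕ) [NeZero d] : Measure (UnitVec d) :=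
  ((volume : Measure (EuclideanSpace ℂ (ZMod d))).toSphere Set.univ)⁻¹ •
    (volume : Measure (EuclideanSpace ℂ (ZMod d))).toSphere

/-! ### Purification fidelity -/

/-- The unnormalised post-selected output `σ_ψ = E(D_δ(ψ)^{⊗n})`. -/
def outputState {d n : ℕ} [NeZero d] (δ : ℝ)
    (E : Matrix (Fin n → ZMod d) (Fin n → ZMod d) ℂ →ₗ[ℂ] Matrix (ZMod d) (ZMod d) ℂ)
    (ψ : UnitVec d) : Matrix (ZMod d) (ZMod d) ℂ :=
  E (tensorPow n (depolarize d δ (pureState ψ)))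

/-- The success probability `∫ tr[σ_ψ] dψ`. -/
def successProb {d n : ℕ} [NeZero d] (δ : ℝ)
    (E : Matrix (Fin n → ZMod d) (Fin n → ZMod d) ℂ →ₗ[ℂ] Matrix (ZMod d) (ZMod d) ℂ) : ℝ :=
  ∫ ψ, (outputState δ E ψ).trace.re ∂(haarState d)

/-- The unnormalised output overlap `∫ tr[σ_ψ ψ] dψ`. -/
def outputOverlap {d n : ℕ} [NeZero d] (δ : ℝ)
    (E : Matrix (Fin n → ZMod d) (Fin n → ZMod d) ℂ →ₗ[ℂ] Matrix (ZMod d) (ZMod d) ℂ) : ℝ :=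
  ∫ ψ, (outputState δ E ψ * pureState ψ).trace.re ∂(haarState d)

/-- The Haar-averaged purification fidelity `∫ tr[σ_ψ ψ] dψ / ∫ tr[σ_ψ] dψ` of a protocol. -/
def avgFidelity {d n : ℕ} [NeZero d] (δ : ℝ)
    (E : Matrix (Fin n → ZMod d) (Fin n → ZMod d) ℂ →ₗ[ℂ] Matrix (ZMod d) (ZMod d) ℂ) : ℝ :=
  outputOverlap δ E / successProb δ E

/-- The Haar-averaged fidelity `∫ tr[D_δ(ψ) ψ] dψ` without purification. -/
def inputFidelity (d : ℕ) [NeZero d] (δ : ℝ) : ℝ :=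
  ∫ ψ, (depolarize d δ (pureState ψ) * pureState ψ).trace.re ∂(haarState d)

/-- The values `(1/p) ∫ tr[σ_ψ ψ] dψ` reached by non-magic protocols on `n` copies whose success
probability is exactly `p`. -/
def fidelityValues (d : ℕ) [NeZero d] (δ : ℝ) (n : ℕ) (p : ℝ) : Set ℝ :=
  {f | ∃ E ∈ nonMagicProtocols d n, successProb δ E = p ∧ f = 1 / p * outputOverlap δ E}

/-- The maximal non-magic universal purification fidelity `F(n, p)`. -/
def maxFidelity (d : ℕ) [NeZero d] (δ : ℝ) (n : ℕ) (p : ℝ) : ℝ :=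
  sSup (fidelityValues d δ n p)

end Purification

end

/-!
Write `s = 1 - δ`, `t = δ / d`, so that `D_δ(ψ) = s ψ + t` and `s + d t = 1`; the fidelity without
purification is `f = s + t`, and it is reached with every success probability by discarding one
copy. For the upper bound one has to show `∫ tr[E(D_δ(ψ) ⊗ D_δ(ψ)) (f - ψ)] dψ ≥ 0`. Homogenizing
with `1 = s + d t` gives (`tens_depolarize_eq`)

`D_δ(ψ) ⊗ D_δ(ψ) ⊗ (f - ψ) = s² ψ ⊗ ψ ⊗ (1 - ψ) + s² t R_ψ + s t² S_ψ + t³ Q_ψ`,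

and each term contributes a non-negative amount. For the first one this is complete positivity for
each single `ψ`. The other three involve `ψ` at most twice, so only the second Haar moment
`∫ ψ ⊗ ψ = (1 + F) / (d (d + 1))` is needed (`integral_fourthMoment`). With `F_ij` the swaps and
`C` a cyclic permutation of the three tensor factors, up to the factor `d (d + 1)`:

* `∫ R_ψ = [(d - 1)(1 - F₁₂) - F₁₃ - F₂₃ + C + C†] + [2 - C - C†]`. The first bracket pairs
  non-negatively with completely positive maps, by Cauchy-Schwarz for the partial trace of an
  antisymmetrized Kraus operator (`sum_norm_partialTrace_le`). The second has a non-negative Wigner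
  function because `|tr[A^u A^v A^w]| ≤ 1` (`norm_tripleTrace_le`).
* `∫ S_ψ = [1 - Π] + [d² + Π - d F₁₃ - d F₂₃]` with `Π = (1/d) ∑_u A^u ⊗ A^u ⊗ A^u`. The partial
  transpose of `Π` in the third factor is an involutive permutation matrix
  (`parityTensor_apply`), so the first bracket pairs non-negatively with completely positive maps;
  the second is `(1/d) ∑ A^u ⊗ A^v ⊗ A^w` over `u ≠ w`, `v ≠ w`.
* `∫ Q_ψ = 0`.

Both kinds of positivity come from applying `id ⊗ E` to the maximally entangled state of two pairs
of `d`-level systems: its Wigner function is non-negative, so the Choi operator of `E` is positive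
semidefinite (`exists_kraus`) and `Re tr[E(A^u ⊗ A^v) A^w] ≥ 0`
(`pairing_choiKernel_pointOp_nonneg`).
-/

namespace Purification

/-! ### Entries of the phase-space point operators -/

section PhaseSpace

variable {d : ℕ} [NeZero d]

lemma boostOp_eq : boostOp d = Matrix.diagonal fun j => (ZMod.stdAddChar j : ℂ) := by
  unfold boostOp
  congr 1
  funext j
  rw [ZMod.stdAddChar_apply, ZMod.toCircle_apply, ← Complex.exp_nat_mul]
  congr 1
  ring

lemma shiftOp_pow_apply (k : ℕ) (x y : ZMod d) :
    (shiftOp d ^ k) x y = if x = y + k then 1 else 0 := by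
  induction k generalizing x y with
  | zero => simp [Matrix.one_apply]
  | succ k ih =>
    rw [pow_succ, Matrix.mul_apply]
    simp only [ih]
    simp only [shiftOp, Matrix.of_apply, mul_ite, mul_one, mul_zero, Finset.sum_ite_eq',
      Finset.mem_univ, if_true]
    congr 1
    push_cast
    rw [add_assoc, add_comm (1 : ZMod d)]

/-- The inverse of `2` in `ℤ_d` for odd `d`. -/
def half (d : ℕ) : ZMod d := (((d + 1) / 2 : ℕ) : ZMod d)

lemma two_mul_half (hd : Odd d) : 2 * half d = 1 := by
  obtain ⟨k, rfl⟩ := hd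
  have h : (2 * k + 1 + 1) / 2 = k + 1 := by omega
  have h0 : ((2 * k + 1 : ℕ) : ZMod (2 * k + 1)) = 0 := ZMod.natCast_self _
  rw [half, h]
  push_cast at h0 ⊢
  linear_combination h0

lemma two_mul_inj (hd : Odd d) {x y : ZMod d} : 2 * x = 2 * y ↔ x = y :=
  ⟨fun h => by linear_combination half d * h - (x - y) * two_mul_half hd, fun h => by rw [h]⟩

lemma tau_eq (hd : Odd d) : tau d = ZMod.stdAddChar (half d) := by
  have h2 : (((d + 1) / 2 : ℕ) : ℂ) * 2 = d + 1 := by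
    obtain ⟨k, rfl⟩ := hd
    have h : (2 * k + 1 + 1) / 2 = k + 1 := by omega
    rw [h]
    push_cast
    ring
  have := ZMod.stdAddChar_coe (N := d) (((d + 1) / 2 : ℕ) : ℤ)
  rw [half, ← Int.cast_natCast, this, tau, ← h2, Int.cast_natCast]
  congr 1
  ring

lemma heisenbergWeyl_apply (hd : Odd d) (u : ZMod d × ZMod d) (x y : ZMod d) :
    heisenbergWeyl d u x y =
      if x = y + u.2 then ZMod.stdAddChar (u.1 * x - half d * u.1 * u.2) else 0 := by
  have hphase : tau d ^ (-((u.1.val : ℤ) * (u.2.val : ℤ))) =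
      ZMod.stdAddChar (-(half d * u.1 * u.2)) := by
    rw [tau_eq hd, ← AddChar.map_zsmul_eq_zpow]
    congr 1
    rw [zsmul_eq_mul]
    push_cast
    rw [ZMod.natCast_zmod_val, ZMod.natCast_zmod_val]
    ring
  rw [heisenbergWeyl, hphase, boostOp_eq, Matrix.diagonal_pow, Matrix.smul_apply,
    Matrix.diagonal_mul, shiftOp_pow_apply, ZMod.natCast_zmod_val, Pi.pow_apply,
    ← AddChar.map_nsmul_eq_pow, nsmul_eq_mul, ZMod.natCast_zmod_val, smul_eq_mul]
  split_ifs
  · rw [mul_one, ← AddChar.map_add_eq_mul]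
    congr 1
    ring
  · simp

lemma sum_stdAddChar_mul (b : ZMod d) :
    ∑ a : ZMod d, (ZMod.stdAddChar (a * b) : ℂ) = if b = 0 then (d : ℂ) else 0 := by
  have := AddChar.sum_mulShift b (ZMod.isPrimitive_stdAddChar d)
  simpa [ZMod.card] using this

/-- The phase-space point operator at the origin is the parity operator `|x⟩ ↦ |-x⟩`. -/
lemma pointOpZero_apply (hd : Odd d) (x y : ZMod d) :
    pointOpZero d x y = if x + y = 0 then 1 else 0 := by
  have hiff : x - half d * (x - y) = 0 ↔ x + y = 0 := by
    rw [← two_mul_inj hd]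
    constructor <;> intro h
    · linear_combination h + (x - y) * two_mul_half hd
    · linear_combination h - (x - y) * two_mul_half hd
  have hterm : ∀ a b : ZMod d, (if x = y + b then
      (ZMod.stdAddChar (a * x - half d * a * b) : ℂ) else 0) =
      if b = x - y then (ZMod.stdAddChar (a * (x - half d * (x - y))) : ℂ) else 0 := by
    intro a b
    have : x = y + b ↔ b = x - y := by
      constructor <;> intro h <;> linear_combination -h
    by_cases hb : b = x - y
    · rw [if_pos hb, if_pos (this.2 hb), hb]
      congr 1
      ring
    · rw [if_neg hb, if_neg (this.not.2 hb)]
  have hd0 : (d : ℂ) ≠ 0 := NeZero.ne _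
  rw [pointOpZero, Matrix.smul_apply, Matrix.sum_apply, Fintype.sum_prod_type]
  simp only [heisenbergWeyl_apply hd, hterm, Finset.sum_ite_eq', Finset.mem_univ, if_true,
    sum_stdAddChar_mul, hiff]
  split_ifs <;> simp [hd0]

/-- The phase-space point operator at `u = (p, q)` is the reflection about the point `q`
with phases `χ(p(x - y))`. -/
lemma pointOp_apply (hd : Odd d) (u : ZMod d × ZMod d) (x y : ZMod d) :
    pointOp d u x y = if x + y = 2 * u.2 then ZMod.stdAddChar (u.1 * (x - y)) else 0 := by
  have h1 : ∀ z w : ZMod d, z = w + u.2 ↔ w = z - u.2 := by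
    intro z w
    constructor <;> intro h <;> linear_combination -h
  rw [pointOp, Matrix.mul_apply]
  have h3 : ∀ z w : ZMod d, z + w = 0 ↔ z = -w := fun z w => add_eq_zero_iff_eq_neg
  have h4 : -(y - u.2) = x - u.2 ↔ x + y = 2 * u.2 := by
    constructor <;> intro h <;> linear_combination -h
  simp only [Matrix.mul_apply, Matrix.conjTranspose_apply, heisenbergWeyl_apply hd,
    pointOpZero_apply hd, h1, h3, apply_ite star, star_zero, ite_mul, zero_mul, mul_ite, mul_zero,
    Finset.sum_ite_eq', Finset.mem_univ, if_true, mul_one, h4]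
  split_ifs
  · rw [Complex.star_def, ← AddChar.map_neg_eq_conj, ← AddChar.map_add_eq_mul]
    congr 1
    ring
  · rfl

/-- Completeness of the phase-space point operators: `∑_u A^u ⊗ A^u` is `d` times the swap. -/
lemma sum_pointOp_mul_pointOp (hd : Odd d) (x y z w : ZMod d) :
    ∑ u, pointOp d u x y * pointOp d u z w = if x = w ∧ y = z then (d : ℂ) else 0 := by
  have hterm : ∀ p q : ZMod d, pointOp d (p, q) x y * pointOp d (p, q) z w =
      if x + y = 2 * q then (if z + w = x + y then
        (ZMod.stdAddChar (p * (x - y + (z - w))) : ℂ) else 0) else 0 := by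
    intro p q
    rw [pointOp_apply hd, pointOp_apply hd]
    by_cases h1 : x + y = 2 * q
    · simp only [h1, if_true, mul_ite, mul_zero, ← AddChar.map_add_eq_mul]
      split_ifs
      · congr 1
        ring
      · rfl
    · simp [h1]
  have hq : ∀ q : ZMod d, x + y = 2 * q ↔ q = half d * (x + y) := by
    intro q
    rw [← two_mul_inj hd (x := q)]
    constructor <;> intro h
    · linear_combination -h - (x + y) * two_mul_half hd
    · linear_combination -h - (x + y) * two_mul_half hd
  rw [Fintype.sum_prod_type]
  simp only [hterm, hq, Finset.sum_ite_eq', Finset.mem_univ, if_true]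
  by_cases h : z + w = x + y
  · simp only [h, if_true, sum_stdAddChar_mul]
    congr 1
    rw [eq_iff_iff]
    constructor
    · intro h3
      constructor <;> rw [← two_mul_inj hd]
      · linear_combination h3 - h
      · linear_combination -h3 - h
    · rintro ⟨rfl, rfl⟩
      ring
  · have : ¬ (x = w ∧ y = z) := by
      rintro ⟨rfl, rfl⟩
      exact h (add_comm _ _)
    simp [h, this]

/-- The phase-space point operators have unit trace. -/
lemma sum_pointOp_diag (hd : Odd d) (u : ZMod d × ZMod d) : ∑ x, pointOp d u x x = 1 := by
  have h : ∀ x : ZMod d, x + x = 2 * u.2 ↔ x = u.2 := fun x => by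
    rw [← two_mul x, two_mul_inj hd]
  simp [pointOp_apply hd, h]

lemma sum_pointOp (hd : Odd d) (x y : ZMod d) :
    ∑ u, pointOp d u x y = if x = y then (d : ℂ) else 0 := by
  have h : ∀ u, pointOp d u x y = ∑ z, pointOp d u x y * pointOp d u z z := fun u => by
    rw [← Finset.mul_sum, sum_pointOp_diag hd, mul_one]
  have h2 : ∀ z, (if x = z ∧ y = z then (d : ℂ) else 0) =
      if x = z then (if x = y then (d : ℂ) else 0) else 0 := by
    intro z
    by_cases h : x = z
    · subst h
      simp [eq_comm]
    · simp [h]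
  rw [Finset.sum_congr rfl fun u _ => h u]
  rw [Finset.sum_comm]
  simp only [sum_pointOp_mul_pointOp hd, h2, Finset.sum_ite_eq, Finset.mem_univ, if_true]

/-- The trace `tr[A^u A^v A^w]`. -/
noncomputable def tripleTrace (u v w : ZMod d × ZMod d) : ℂ :=
  ∑ y, ∑ z, ∑ x, pointOp d u x y * pointOp d v y z * pointOp d w z x

/-- A product of three reflections is a phase times a reflection, so its trace is a phase. -/
lemma norm_tripleTrace_le (hd : Odd d) (u v w : ZMod d × ZMod d) : ‖tripleTrace u v w‖ ≤ 1 := by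
  have hbound : ∀ x y z, ‖pointOp d u x y * pointOp d v y z * pointOp d w z x‖ ≤
      if y = u.2 + v.2 - w.2 then (if z = v.2 + w.2 - u.2 then
        (if x = u.2 + w.2 - v.2 then 1 else 0) else 0) else 0 := by
    intro x y z
    simp only [pointOp_apply hd]
    by_cases h : x + y = 2 * u.2 ∧ y + z = 2 * v.2 ∧ z + x = 2 * w.2
    · obtain ⟨h1, h2, h3⟩ := h
      have hx : x = u.2 + w.2 - v.2 := by
        rw [← two_mul_inj hd]; linear_combination h1 - h2 + h3
      have hy : y = u.2 + v.2 - w.2 := by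
        rw [← two_mul_inj hd]; linear_combination h1 + h2 - h3
      have hz : z = v.2 + w.2 - u.2 := by
        rw [← two_mul_inj hd]; linear_combination -h1 + h2 + h3
      rw [if_pos h1, if_pos h2, if_pos h3, if_pos hy, if_pos hz, if_pos hx]
      simp [AddChar.norm_apply]
    · have : (if x + y = 2 * u.2 then (ZMod.stdAddChar (u.1 * (x - y)) : ℂ) else 0) *
          (if y + z = 2 * v.2 then (ZMod.stdAddChar (v.1 * (y - z)) : ℂ) else 0) *
          (if z + x = 2 * w.2 then (ZMod.stdAddChar (w.1 * (z - x)) : ℂ) else 0) = 0 := by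
        by_contra hne
        simp only [mul_eq_zero, not_or, ite_eq_right_iff, not_forall] at hne
        exact h ⟨hne.1.1.1, hne.1.2.1, hne.2.1⟩
      rw [this, norm_zero]
      split_ifs <;> norm_num
  calc ‖tripleTrace u v w‖ ≤ ∑ y, ∑ z, ∑ x, ‖pointOp d u x y * pointOp d v y z * pointOp d w z x‖ :=
        (norm_sum_le _ _).trans <| Finset.sum_le_sum fun y _ => (norm_sum_le _ _).trans <|
          Finset.sum_le_sum fun z _ => norm_sum_le _ _
    _ ≤ _ := Finset.sum_le_sum fun y _ => Finset.sum_le_sum fun z _ =>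
        Finset.sum_le_sum fun x _ => hbound x y z
    _ = 1 := by simp

/-- The phase-space point operators are Hermitian. -/
lemma star_pointOp (hd : Odd d) (u : ZMod d × ZMod d) (x y : ZMod d) :
    star (pointOp d u x y) = pointOp d u y x := by
  rw [pointOp_apply hd, pointOp_apply hd, add_comm y x]
  split_ifs
  · rw [Complex.star_def, ← AddChar.map_neg_eq_conj]
    congr 1
    ring
  · simp

/-- Transposition maps the phase-space point operator at `(p, q)` to the one at `(-p, q)`. -/
lemma pointOp_transpose (hd : Odd d) (u : ZMod d × ZMod d) (x y : ZMod d) :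
    pointOp d u y x = pointOp d (-u.1, u.2) x y := by
  rw [pointOp_apply hd, pointOp_apply hd, add_comm y x]
  simp only [neg_mul, ← mul_neg, neg_sub]

end PhaseSpace

/-! ### Haar moments -/

section SphereInvariance

open Pointwise

variable {E : Type*} [NormedAddCommGroup E] [InnerProductSpace ℝ E]

/-- The action of a linear isometry on the unit sphere. -/
def sphereMap (f : E ≃ₗᵢ[ℝ] E) (ψ : Metric.sphere (0 : E) 1) : Metric.sphere (0 : E) 1 :=
  ⟨f ψ, by simp⟩

lemma continuous_sphereMap (f : E ≃ₗᵢ[ℝ] E) : Continuous (sphereMap f) :=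
  (f.continuous.comp continuous_subtype_val).subtype_mk _

lemma map_sphereMap_toSphere [FiniteDimensional ℝ E] [MeasurableSpace E] [BorelSpace E]
    (f : E ≃ₗᵢ[ℝ] E) :
    ((volume : Measure E).toSphere).map (sphereMap f) = (volume : Measure E).toSphere := by
  ext s hs
  have hm := (continuous_sphereMap f).measurable
  have hset : Set.Ioo (0 : ℝ) 1 • (Subtype.val '' (sphereMap f ⁻¹' s)) =
      f ⁻¹' (Set.Ioo (0 : ℝ) 1 • (Subtype.val '' s)) := by
    ext x
    simp only [Set.mem_smul, Set.mem_preimage, Set.mem_image]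
    constructor
    · rintro ⟨r, hr, _, ⟨φ, hφ, rfl⟩, rfl⟩
      exact ⟨r, hr, f φ, ⟨sphereMap f φ, hφ, rfl⟩, by simp⟩
    · rintro ⟨r, hr, _, ⟨φ, hφ, rfl⟩, hx⟩
      refine ⟨r, hr, f.symm φ, ⟨⟨f.symm φ, by simp⟩, ?_, rfl⟩, ?_⟩
      · have : sphereMap f ⟨f.symm φ, by simp⟩ = φ := Subtype.ext (by simp [sphereMap])
        rw [this]
        exact hφ
      · apply f.injective
        rw [← hx]
        simp
  rw [Measure.map_apply hm hs, Measure.toSphere_apply' _ (hm hs), Measure.toSphere_apply' _ hs,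
    hset, f.measurePreserving.measure_preimage_emb f.toHomeomorph.measurableEmbedding]

end SphereInvariance

section HaarMoments

variable {d : ℕ} [NeZero d]

instance : IsProbabilityMeasure (haarState d) := by
  constructor
  rw [haarState, Measure.smul_apply, smul_eq_mul]
  exact ENNReal.inv_mul_cancel (Measure.measure_univ_ne_zero.2 (Measure.toSphere_ne_zero _))
    (measure_ne_top _ _)

lemma integral_haarState_isometry {F : Type*} [NormedAddCommGroup F] [NormedSpace ℝ F]
    (f : EuclideanSpace ℂ (ZMod d) ≃ₗᵢ[ℂ] EuclideanSpace ℂ (ZMod d))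
    {g : EuclideanSpace ℂ (ZMod d) → F} (hg : Continuous g) :
    ∫ ψ, g (f (ψ : UnitVec d)) ∂(haarState d) = ∫ ψ, g (ψ : UnitVec d) ∂(haarState d) := by
  let f' : EuclideanSpace ℂ (ZMod d) ≃ₗᵢ[ℝ] EuclideanSpace ℂ (ZMod d) :=
    { f.toLinearEquiv.restrictScalars ℝ with norm_map' := f.norm_map }
  have hmap : (haarState d).map (sphereMap f') = haarState d := by
    rw [haarState, Measure.map_smul, map_sphereMap_toSphere]
  have hc : Continuous fun ψ : UnitVec d => g ψ := hg.comp continuous_subtype_val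
  conv_rhs => rw [← hmap]
  rw [integral_map (continuous_sphereMap f').aemeasurable hc.aestronglyMeasurable]
  rfl

lemma integrable_haarState {F : Type*} [NormedAddCommGroup F] {g : UnitVec d → F}
    (hg : Continuous g) : Integrable g (haarState d) :=
  hg.integrable_of_hasCompactSupport (HasCompactSupport.of_compactSpace g)

/-- Multiplication of the coordinate `a` by the imaginary unit. -/
noncomputable def phaseIsometry (a : ZMod d) :
    EuclideanSpace ℂ (ZMod d) ≃ₗᵢ[ℂ] EuclideanSpace ℂ (ZMod d) :=
  LinearIsometryEquiv.piLpCongrRight 2 fun x =>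
    { LinearEquiv.smulOfUnit (if x = a then Units.mk0 Complex.I Complex.I_ne_zero else 1) with
      norm_map' := fun z => by
        change ‖(if x = a then Units.mk0 Complex.I Complex.I_ne_zero else 1) • z‖ = ‖z‖
        split_ifs <;> simp [Units.smul_def] }

lemma phaseIsometry_apply (a x : ZMod d) (ψ : EuclideanSpace ℂ (ZMod d)) :
    phaseIsometry a ψ x = (if x = a then Complex.I else 1) * ψ x := by
  change (if x = a then Units.mk0 Complex.I Complex.I_ne_zero else 1) • ψ x = _
  split_ifs <;> simp [Units.smul_def]

lemma fourthMoment_eq_zero {x y z w : ZMod d} (h : ¬ (x = y ∧ z = w)) (h' : ¬ (x = w ∧ z = y)) :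
    ∫ ψ : UnitVec d, ψ.1 x * star (ψ.1 y) * (ψ.1 z * star (ψ.1 w)) ∂(haarState d) = 0 := by
  have hI : Complex.I ≠ 1 := fun h => by simpa using congrArg Complex.im h
  -- a coordinate `a` that occurs more often in `{x, z}` than in `{y, w}`
  obtain ⟨a, ha⟩ : ∃ a : ZMod d, (if x = a then Complex.I else 1) *
      star (if y = a then Complex.I else 1) * ((if z = a then Complex.I else 1) *
        star (if w = a then Complex.I else 1)) ≠ 1 := by
    by_cases hxy : x = y
    · have hzw : w ≠ z := fun hzw => h ⟨hxy, hzw.symm⟩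
      refine ⟨z, ?_⟩
      subst hxy
      by_cases hxz : x = z <;> simp [hxz, hzw, hI]
    · by_cases hxw : x = w
      · have hzy : y ≠ z := fun hzy => h' ⟨hxw, hzy.symm⟩
        refine ⟨z, ?_⟩
        subst hxw
        by_cases hxz : x = z <;> simp [hxz, hzy, hI]
      · refine ⟨x, ?_⟩
        by_cases hxz : z = x
        · simp [hxz, Ne.symm hxy, Ne.symm hxw]
          norm_num [Complex.ext_iff]
        · simp [hxz, Ne.symm hxy, Ne.symm hxw, hI]
  have hinv := integral_haarState_isometry (phaseIsometry a)
    (g := fun φ : EuclideanSpace ℂ (ZMod d) => φ x * star (φ y) * (φ z * star (φ w)))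
    (by fun_prop)
  have hfac : ∀ ψ : UnitVec d,
      phaseIsometry a ψ.1 x * star (phaseIsometry a ψ.1 y) *
        (phaseIsometry a ψ.1 z * star (phaseIsometry a ψ.1 w)) =
      ((if x = a then Complex.I else 1) * star (if y = a then Complex.I else 1) *
        ((if z = a then Complex.I else 1) * star (if w = a then Complex.I else 1))) *
        (ψ.1 x * star (ψ.1 y) * (ψ.1 z * star (ψ.1 w))) := by
    intro ψ
    simp only [phaseIsometry_apply, star_mul']
    ring
  simp only [hfac] at hinv
  rw [integral_const_mul] at hinv
  by_contra hne
  exact ha (mul_right_cancel₀ hne (hinv.trans (one_mul _).symm))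

/-- The reflection in the line spanned by `u`, in coordinates. -/
lemma reflection_span_apply (u v : EuclideanSpace ℂ (ZMod d)) (x : ZMod d) :
    (Submodule.span ℂ {u}).reflection v x =
      2 * (inner ℂ u v / (‖u‖ : ℂ) ^ 2) * u x - v x := by
  rw [Submodule.reflection_singleton_apply]
  simp [two_smul, two_mul, add_mul]

lemma integral_normSq_sq_eq {x z : ZMod d} (hxz : x ≠ z) :
    ∫ ψ : UnitVec d, ‖ψ.1 x‖ ^ 2 * ‖ψ.1 x‖ ^ 2 ∂(haarState d) =
      ∫ ψ : UnitVec d, ‖ψ.1 z‖ ^ 2 * ‖ψ.1 z‖ ^ 2 ∂(haarState d) := by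
  -- the reflection in `e_x - e_z` exchanges the coordinates `x` and `z` up to a sign
  let u : EuclideanSpace ℂ (ZMod d) := EuclideanSpace.single x 1 - EuclideanSpace.single z 1
  have hu : (‖u‖ : ℂ) ^ 2 = 2 := by
    refine (inner_self_eq_norm_sq_to_K (𝕜 := ℂ) u).symm.trans ?_
    simp only [u, inner_sub_left, inner_sub_right, EuclideanSpace.inner_single_left]
    simp [hxz, hxz.symm]
    norm_num
  have hR : ∀ v : EuclideanSpace ℂ (ZMod d), (Submodule.span ℂ {u}).reflection v x = - v z := by
    intro v
    rw [reflection_span_apply, hu]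
    simp [u, EuclideanSpace.inner_single_left, hxz]
    ring
  have hinv := integral_haarState_isometry (Submodule.span ℂ {u}).reflection
    (g := fun φ : EuclideanSpace ℂ (ZMod d) => ‖φ x‖ ^ 2 * ‖φ x‖ ^ 2) (by fun_prop)
  simpa [hR] using hinv.symm

lemma integral_normSq_mul_normSq {x z : ZMod d} (hxz : x ≠ z) :
    ∫ ψ : UnitVec d, ‖ψ.1 x‖ ^ 2 * ‖ψ.1 x‖ ^ 2 ∂(haarState d) =
      2 * ∫ ψ : UnitVec d, ‖ψ.1 x‖ ^ 2 * ‖ψ.1 z‖ ^ 2 ∂(haarState d) := by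
  have hrot : ∀ c : ℂ, ‖c‖ = 1 →
      ∫ ψ : UnitVec d, ‖4 * c * ψ.1 z - 3 * ψ.1 x‖ ^ 2 * ‖4 * c * ψ.1 z - 3 * ψ.1 x‖ ^ 2
        ∂(haarState d) =
      625 * ∫ ψ : UnitVec d, ‖ψ.1 x‖ ^ 2 * ‖ψ.1 x‖ ^ 2 ∂(haarState d) := by
    intro c hc
    -- the reflection in `e_x + 2 c̄ e_z` sends `ψ_x` to `(4 c ψ_z - 3 ψ_x) / 5`
    let u : EuclideanSpace ℂ (ZMod d) :=
      EuclideanSpace.single x 1 + EuclideanSpace.single z (2 * star c)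
    have hcc : c * star c = 1 := by
      rw [Complex.star_def, Complex.mul_conj, Complex.normSq_eq_norm_sq, hc]
      norm_num
    have hu : (‖u‖ : ℂ) ^ 2 = 5 := by
      refine (inner_self_eq_norm_sq_to_K (𝕜 := ℂ) u).symm.trans ?_
      simp only [u, inner_add_left, inner_add_right, EuclideanSpace.inner_single_left]
      simp [hxz, hxz.symm, Complex.conj_ofNat]
      rw [Complex.star_def] at hcc
      linear_combination 4 * hcc
    have hR : ∀ v : EuclideanSpace ℂ (ZMod d),
        (Submodule.span ℂ {u}).reflection v x = (4 * c * v z - 3 * v x) / 5 := by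
      intro v
      rw [reflection_span_apply, hu]
      simp [u, EuclideanSpace.inner_single_left, hxz, Complex.conj_ofNat]
      ring
    have hinv := integral_haarState_isometry (Submodule.span ℂ {u}).reflection
      (g := fun φ : EuclideanSpace ℂ (ZMod d) => ‖φ x‖ ^ 2 * ‖φ x‖ ^ 2) (by fun_prop)
    rw [← hinv, ← integral_const_mul]
    congr 1
    funext ψ
    rw [hR, norm_div]
    norm_num
    ring
  -- averaging over the fourth roots of unity `c` removes the cross terms
  have hpt : ∀ a b : ℂ,
      ‖4 * 1 * b - 3 * a‖ ^ 2 * ‖4 * 1 * b - 3 * a‖ ^ 2 +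
      ‖4 * (-1) * b - 3 * a‖ ^ 2 * ‖4 * (-1) * b - 3 * a‖ ^ 2 +
      (‖4 * Complex.I * b - 3 * a‖ ^ 2 * ‖4 * Complex.I * b - 3 * a‖ ^ 2 +
      ‖4 * (-Complex.I) * b - 3 * a‖ ^ 2 * ‖4 * (-Complex.I) * b - 3 * a‖ ^ 2) =
      1024 * (‖b‖ ^ 2 * ‖b‖ ^ 2) + 324 * (‖a‖ ^ 2 * ‖a‖ ^ 2) +
        2304 * (‖a‖ ^ 2 * ‖b‖ ^ 2) := by
    intro a b
    simp only [Complex.sq_norm, Complex.normSq_apply, Complex.sub_re, Complex.sub_im,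
      Complex.mul_re, Complex.mul_im, Complex.neg_re, Complex.neg_im, Complex.one_re,
      Complex.one_im, Complex.I_re, Complex.I_im, Complex.re_ofNat, Complex.im_ofNat]
    ring
  have hsum := congrArg (fun g : UnitVec d → ℝ => ∫ ψ, g ψ ∂(haarState d))
    (funext fun ψ : UnitVec d => hpt (ψ.1 x) (ψ.1 z))
  simp only at hsum
  rw [integral_add, integral_add, integral_add, integral_add, integral_add, integral_const_mul,
    integral_const_mul, integral_const_mul, hrot 1 (by simp), hrot (-1) (by simp),
    hrot Complex.I (by simp), hrot (-Complex.I) (by simp), ← integral_normSq_sq_eq hxz] at hsum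
  · linarith
  all_goals exact integrable_haarState (by fun_prop)

lemma sum_normSq_unitVec (ψ : UnitVec d) : ∑ x, ‖ψ.1 x‖ ^ 2 = 1 := by
  rw [← EuclideanSpace.norm_sq_eq]
  simp

lemma sum_mul_star_unitVec (ψ : UnitVec d) : ∑ x, ψ.1 x * star (ψ.1 x) = 1 := by
  have h : ∀ z : ℂ, z * star z = ((‖z‖ ^ 2 : ℝ) : ℂ) := fun z => by
    rw [Complex.star_def, Complex.mul_conj, Complex.normSq_eq_norm_sq]
  simp only [h]
  rw [← Complex.ofReal_sum, sum_normSq_unitVec, Complex.ofReal_one]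

lemma integral_normSq_mul_normSq_eq (x z : ZMod d) :
    ∫ ψ : UnitVec d, ‖ψ.1 x‖ ^ 2 * ‖ψ.1 z‖ ^ 2 ∂(haarState d) =
      (1 + if x = z then 1 else 0) / ((d : ℝ) * (d + 1)) := by
  set q := (∫ ψ : UnitVec d, ‖ψ.1 0‖ ^ 2 * ‖ψ.1 0‖ ^ 2 ∂(haarState d)) / 2 with hq
  have hdiag : ∀ x, ∫ ψ : UnitVec d, ‖ψ.1 x‖ ^ 2 * ‖ψ.1 x‖ ^ 2 ∂(haarState d) = 2 * q := by
    intro x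
    rw [hq]
    by_cases hx : x = 0
    · rw [hx]; ring
    · rw [integral_normSq_sq_eq hx]; ring
  have hall : ∀ x z, ∫ ψ : UnitVec d, ‖ψ.1 x‖ ^ 2 * ‖ψ.1 z‖ ^ 2 ∂(haarState d) =
      (1 + if x = z then 1 else 0) * q := by
    intro x z
    by_cases hxz : x = z
    · rw [if_pos hxz, ← hxz, hdiag]; ring
    · have := integral_normSq_mul_normSq hxz
      rw [hdiag] at this
      rw [if_neg hxz]; linarith
  have hnorm : ((d : ℝ) * (d + 1)) * q = 1 := by
    have h1 : ∑ x : ZMod d, ∑ z : ZMod d,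
        ∫ ψ : UnitVec d, ‖ψ.1 x‖ ^ 2 * ‖ψ.1 z‖ ^ 2 ∂(haarState d) = 1 := by
      have h2 : ∀ x : ZMod d, ∑ z : ZMod d,
          ∫ ψ : UnitVec d, ‖ψ.1 x‖ ^ 2 * ‖ψ.1 z‖ ^ 2 ∂(haarState d) =
          ∫ ψ : UnitVec d, ‖ψ.1 x‖ ^ 2 ∂(haarState d) := by
        intro x
        rw [← integral_finsetSum _ fun z _ => integrable_haarState (by fun_prop)]
        simp only [← Finset.mul_sum, sum_normSq_unitVec, mul_one]
      simp only [h2]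
      rw [← integral_finsetSum _ fun z _ => integrable_haarState (by fun_prop)]
      simp [sum_normSq_unitVec]
    simp only [hall, ← Finset.sum_mul, Finset.sum_add_distrib, Finset.sum_const,
      Finset.card_univ, ZMod.card, Finset.sum_ite_eq, Finset.mem_univ, if_true,
      nsmul_eq_mul] at h1
    linarith
  have hd : ((d : ℝ) * (d + 1)) ≠ 0 := fun h => by rw [h, zero_mul] at hnorm; norm_num at hnorm
  rw [hall, eq_div_iff hd]
  linear_combination (1 + if x = z then 1 else 0) * hnorm

/-- The second Haar moment: `∫ ψ ⊗ ψ dψ = (1 + F) / (d (d + 1))` with `F` the swap. -/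
lemma integral_fourthMoment (x y z w : ZMod d) :
    ∫ ψ : UnitVec d, ψ.1 x * star (ψ.1 y) * (ψ.1 z * star (ψ.1 w)) ∂(haarState d) =
      ((if x = y ∧ z = w then 1 else 0) + (if x = w ∧ z = y then 1 else 0)) /
        ((d : ℂ) * (d + 1)) := by
  have hP : ∀ x z : ZMod d,
      ∫ ψ : UnitVec d, ψ.1 x * star (ψ.1 x) * (ψ.1 z * star (ψ.1 z)) ∂(haarState d) =
        (1 + if x = z then 1 else 0) / ((d : ℂ) * (d + 1)) := by
    intro x z
    have h : ∀ ψ : UnitVec d, ψ.1 x * star (ψ.1 x) * (ψ.1 z * star (ψ.1 z)) =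
        ((‖ψ.1 x‖ ^ 2 * ‖ψ.1 z‖ ^ 2 : ℝ) : ℂ) := by
      intro ψ
      rw [Complex.star_def, Complex.mul_conj, Complex.normSq_eq_norm_sq, Complex.mul_conj,
        Complex.normSq_eq_norm_sq]
      push_cast
      rfl
    simp only [h]
    rw [integral_complex_ofReal, integral_normSq_mul_normSq_eq]
    push_cast [apply_ite Complex.ofReal]
    rfl
  by_cases h : x = y ∧ z = w
  · obtain ⟨rfl, rfl⟩ := h
    rw [hP]
    simp [eq_comm]
  · by_cases h' : x = w ∧ z = y
    · obtain ⟨rfl, rfl⟩ := h'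
      have hswap : ∀ ψ : UnitVec d, ψ.1 x * star (ψ.1 z) * (ψ.1 z * star (ψ.1 x)) =
          ψ.1 x * star (ψ.1 x) * (ψ.1 z * star (ψ.1 z)) := fun ψ => by ring
      simp only [hswap]
      rw [hP]
      have hxz : x ≠ z := fun hxz => h ⟨hxz, hxz.symm⟩
      simp [hxz]
    · rw [fourthMoment_eq_zero h h', if_neg h, if_neg h']
      simp

/-- The first Haar moment: `∫ ψ dψ = 1 / d`. -/
lemma integral_secondMoment (x y : ZMod d) :
    ∫ ψ : UnitVec d, ψ.1 x * star (ψ.1 y) ∂(haarState d) = (if x = y then 1 else 0) / (d : ℂ) := by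
  have h : ∀ ψ : UnitVec d, ψ.1 x * star (ψ.1 y) =
      ∑ z, ψ.1 x * star (ψ.1 y) * (ψ.1 z * star (ψ.1 z)) := fun ψ => by
    rw [← Finset.mul_sum, sum_mul_star_unitVec, mul_one]
  have h2 : ∀ z, (if x = z ∧ z = y then (1 : ℂ) else 0) =
      if x = z then (if x = y then 1 else 0) else 0 := by
    intro z
    by_cases h : x = z
    · simp [h]
    · simp [h]
  have hd : (d : ℂ) ≠ 0 := NeZero.ne _
  have hd1 : (d : ℂ) + 1 ≠ 0 := by exact_mod_cast Nat.succ_ne_zero d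
  rw [integral_congr_ae (Filter.Eventually.of_forall h),
    integral_finsetSum _ fun z _ => integrable_haarState (by fun_prop)]
  simp only [integral_fourthMoment, and_true, h2, ← Finset.sum_div, Finset.sum_add_distrib,
    Finset.sum_ite_eq, Finset.mem_univ, if_true, Finset.sum_const, Finset.card_univ, ZMod.card,
    nsmul_eq_mul]
  field_simp

end HaarMoments

/-! ### Operators on three systems -/

section Tensors

variable {d : ℕ} [NeZero d]

/-- Operators on `(ℂ^d)^{⊗3}`, given by their entries `M x₁ y₁ x₂ y₂ x₃ y₃`, where `xᵢ` is the row
index and `yᵢ` the column index of the `i`-th factor. -/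
abbrev Tensor (d : ℕ) : Type :=
  ZMod d → ZMod d → ZMod d → ZMod d → ZMod d → ZMod d → ℂ

/-- The operator `A ⊗ B ⊗ C`. -/
def tens (A B C : Matrix (ZMod d) (ZMod d) ℂ) : Tensor d :=
  fun x₁ y₁ x₂ y₂ x₃ y₃ => A x₁ y₁ * B x₂ y₂ * C x₃ y₃

/-- The pairing of an operator on `(ℂ^d)^{⊗3}` with a kernel; for the kernel
`⟨y₃| E(|x₁x₂⟩⟨y₁y₂|) |x₃⟩` of a map `E` it sends `A ⊗ B ⊗ C` to `tr[E(A ⊗ B) C]`. -/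
def pairing (J : Tensor d) : Tensor d →ₗ[ℂ] ℂ where
  toFun M := ∑ x₁, ∑ x₂, ∑ y₃, ∑ y₁, ∑ y₂, ∑ x₃,
    M x₁ y₁ x₂ y₂ x₃ y₃ * J x₁ y₁ x₂ y₂ x₃ y₃
  map_add' M N := by simp only [Pi.add_apply, add_mul, Finset.sum_add_distrib]
  map_smul' c M := by
    simp only [Pi.smul_apply, smul_eq_mul, mul_assoc, ← Finset.mul_sum, RingHom.id_apply]

lemma pairing_apply (J M : Tensor d) : pairing J M = ∑ x₁, ∑ x₂, ∑ y₃, ∑ y₁, ∑ y₂, ∑ x₃,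
    M x₁ y₁ x₂ y₂ x₃ y₃ * J x₁ y₁ x₂ y₂ x₃ y₃ := rfl

lemma pairing_sum {ι : Type*} (J : Tensor d) (s : Finset ι) (M : ι → Tensor d) :
    pairing J (∑ i ∈ s, M i) = ∑ i ∈ s, pairing J (M i) := by
  classical
  induction s using Finset.induction_on with
  | empty => simp only [Finset.sum_empty, LinearMap.map_zero]
  | insert a s ha ih => rw [Finset.sum_insert ha, Finset.sum_insert ha, LinearMap.map_add, ih]

lemma pairing_comm (J M : Tensor d) : pairing J M = pairing M J := by
  simp only [pairing_apply, mul_comm]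

/-- The kernel of the map `ρ ↦ K ρ K†`, where `K z x₁ x₂ = ⟨z|K|x₁x₂⟩`. -/
def krausKernel (K : ZMod d → ZMod d → ZMod d → ℂ) : Tensor d :=
  fun x₁ y₁ x₂ y₂ x₃ y₃ => K y₃ x₁ x₂ * star (K x₃ y₁ y₂)

/-- The exchange of the first two tensor factors. -/
def swap₁₂ (d : ℕ) : Tensor d := fun x₁ y₁ x₂ y₂ x₃ y₃ =>
  (1 : Matrix (ZMod d) (ZMod d) ℂ) x₁ y₂ * (1 : Matrix (ZMod d) (ZMod d) ℂ) x₂ y₁ *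
    (1 : Matrix (ZMod d) (ZMod d) ℂ) x₃ y₃

/-- The exchange of the first and the third tensor factor. -/
def swap₁₃ (d : ℕ) : Tensor d := fun x₁ y₁ x₂ y₂ x₃ y₃ =>
  (1 : Matrix (ZMod d) (ZMod d) ℂ) x₁ y₃ * (1 : Matrix (ZMod d) (ZMod d) ℂ) x₂ y₂ *
    (1 : Matrix (ZMod d) (ZMod d) ℂ) x₃ y₁

/-- The exchange of the last two tensor factors. -/
def swap₂₃ (d : ℕ) : Tensor d := fun x₁ y₁ x₂ y₂ x₃ y₃ =>
  (1 : Matrix (ZMod d) (ZMod d) ℂ) x₁ y₁ * (1 : Matrix (ZMod d) (ZMod d) ℂ) x₂ y₃ *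
    (1 : Matrix (ZMod d) (ZMod d) ℂ) x₃ y₂

/-- A cyclic permutation of the tensor factors. -/
def cycle (d : ℕ) : Tensor d := fun x₁ y₁ x₂ y₂ x₃ y₃ =>
  (1 : Matrix (ZMod d) (ZMod d) ℂ) x₁ y₂ * (1 : Matrix (ZMod d) (ZMod d) ℂ) x₂ y₃ *
    (1 : Matrix (ZMod d) (ZMod d) ℂ) x₃ y₁

/-- The inverse of the cyclic permutation `cycle`. -/
def cycleInv (d : ℕ) : Tensor d := fun x₁ y₁ x₂ y₂ x₃ y₃ =>
  (1 : Matrix (ZMod d) (ZMod d) ℂ) x₁ y₃ * (1 : Matrix (ZMod d) (ZMod d) ℂ) x₂ y₁ *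
    (1 : Matrix (ZMod d) (ZMod d) ℂ) x₃ y₂

/-- The operator `(1/d) ∑_u A^u ⊗ A^u ⊗ A^u`. -/
noncomputable def parityTensor (d : ℕ) [NeZero d] : Tensor d :=
  (d : ℂ)⁻¹ • ∑ u, tens (pointOp d u) (pointOp d u) (pointOp d u)

/-! ### Positivity for Kraus operators -/

section Kraus

variable (K : ZMod d → ZMod d → ZMod d → ℂ)

lemma pairing_krausKernel_one : pairing (krausKernel K) (tens 1 1 1) =
    ∑ x, ∑ y, ∑ z, K z x y * star (K z x y) := by
  simp only [pairing_apply, krausKernel, tens, Matrix.one_apply, mul_ite, ite_mul, mul_one,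
    one_mul, mul_zero, zero_mul, Finset.sum_ite_eq, Finset.sum_ite_eq', Finset.mem_univ, if_true]

lemma pairing_krausKernel_swap₁₂ : pairing (krausKernel K) (swap₁₂ d) =
    ∑ x, ∑ y, ∑ z, K z x y * star (K z y x) := by
  simp only [pairing_apply, krausKernel, swap₁₂, Matrix.one_apply, mul_ite, ite_mul, mul_one,
    one_mul, mul_zero, zero_mul, Finset.sum_ite_eq, Finset.sum_ite_eq', Finset.mem_univ, if_true,
    Finset.sum_ite_irrel, Finset.sum_const_zero]

lemma pairing_krausKernel_swap₁₃ : pairing (krausKernel K) (swap₁₃ d) =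
    ∑ y, (∑ x, K x x y) * star (∑ x, K x x y) := by
  simp only [pairing_apply, krausKernel, swap₁₃, Matrix.one_apply, mul_ite, ite_mul, mul_one,
    one_mul, mul_zero, zero_mul, Finset.sum_ite_eq, Finset.sum_ite_eq', Finset.mem_univ, if_true,
    Finset.sum_ite_irrel, Finset.sum_const_zero, star_sum, Finset.sum_mul_sum]
  rw [Finset.sum_comm]

lemma pairing_krausKernel_swap₂₃ : pairing (krausKernel K) (swap₂₃ d) =
    ∑ y, (∑ x, K x y x) * star (∑ x, K x y x) := by
  simp only [pairing_apply, krausKernel, swap₂₃, Matrix.one_apply, mul_ite, ite_mul, mul_one,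
    one_mul, mul_zero, zero_mul, Finset.sum_ite_eq, Finset.sum_ite_eq', Finset.mem_univ, if_true,
    Finset.sum_ite_irrel, Finset.sum_const_zero, star_sum, Finset.sum_mul_sum]

lemma pairing_krausKernel_cycle : pairing (krausKernel K) (cycle d) =
    ∑ y, (∑ x, K x y x) * star (∑ x, K x x y) := by
  simp only [pairing_apply, krausKernel, cycle, Matrix.one_apply, mul_ite, ite_mul, mul_one,
    one_mul, mul_zero, zero_mul, Finset.sum_ite_eq, Finset.sum_ite_eq', Finset.mem_univ, if_true,
    Finset.sum_ite_irrel, Finset.sum_const_zero, star_sum, Finset.sum_mul_sum]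

lemma pairing_krausKernel_cycleInv : pairing (krausKernel K) (cycleInv d) =
    ∑ y, (∑ x, K x x y) * star (∑ x, K x y x) := by
  simp only [pairing_apply, krausKernel, cycleInv, Matrix.one_apply, mul_ite, ite_mul, mul_one,
    one_mul, mul_zero, zero_mul, Finset.sum_ite_eq, Finset.sum_ite_eq', Finset.mem_univ, if_true,
    Finset.sum_ite_irrel, Finset.sum_const_zero, star_sum, Finset.sum_mul_sum]
  rw [Finset.sum_comm]

lemma mul_star_eq_normSq (z : ℂ) : z * star z = ((‖z‖ ^ 2 : ℝ) : ℂ) := by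
  rw [Complex.star_def, Complex.mul_conj, Complex.normSq_eq_norm_sq]

/-- The partial trace of an operator that is antisymmetric in its two inputs is controlled by
Cauchy-Schwarz: the term `x = y` of the inner sum
vanishes, which leaves `d - 1` terms. -/
lemma sum_norm_partialTrace_le (g : ZMod d → ZMod d → ZMod d → ℂ)
    (hg : ∀ z x y, g z y x = -g z x y) :
    ∑ y, ‖∑ x, g x x y‖ ^ 2 ≤ ((d : ℝ) - 1) / 2 * ∑ x, ∑ y, ∑ z, ‖g z x y‖ ^ 2 := by
  have h0 : ∀ z x, g z x x = 0 := fun z x => self_eq_neg.1 (hg z x x)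
  have hd1 : (0 : ℝ) ≤ (d : ℝ) - 1 := by
    have : 1 ≤ d := NeZero.one_le
    have : (1 : ℝ) ≤ d := by exact_mod_cast this
    linarith
  have hcs : ∀ y, ‖∑ x, g x x y‖ ^ 2 ≤ ((d : ℝ) - 1) * ∑ x, ‖g x x y‖ ^ 2 := by
    intro y
    have herase : ∑ x, g x x y = ∑ x ∈ Finset.univ.erase y, g x x y := by
      rw [← Finset.add_sum_erase _ _ (Finset.mem_univ y), h0, zero_add]
    have hcard : ((Finset.univ.erase y).card : ℝ) = (d : ℝ) - 1 := by
      rw [Finset.card_erase_of_mem (Finset.mem_univ y), Finset.card_univ, ZMod.card,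
        Nat.cast_sub NeZero.one_le, Nat.cast_one]
    calc ‖∑ x, g x x y‖ ^ 2 ≤ (∑ x ∈ Finset.univ.erase y, ‖g x x y‖) ^ 2 := by
          rw [herase]
          gcongr
          exact norm_sum_le _ _
      _ ≤ ((d : ℝ) - 1) * ∑ x ∈ Finset.univ.erase y, ‖g x x y‖ ^ 2 := by
          rw [← hcard]
          exact sq_sum_le_card_mul_sum_sq
      _ ≤ _ := by
          gcongr
          exact Finset.erase_subset _ _
  have hpt : ∀ z x y, (if x = z then ‖g z z y‖ ^ 2 else 0) + (if y = z then ‖g z z x‖ ^ 2 else 0) ≤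
      ‖g z x y‖ ^ 2 := by
    intro z x y
    by_cases hx : x = z
    · by_cases hy : y = z
      · subst hx
        subst hy
        simp [h0]
      · subst hx
        simp [hy]
    · by_cases hy : y = z
      · subst hy
        rw [if_neg hx, if_pos rfl, zero_add, hg y x y, norm_neg]
      · simp [hx, hy]
  have htwo : 2 * ∑ y, ∑ x, ‖g x x y‖ ^ 2 ≤ ∑ x, ∑ y, ∑ z, ‖g z x y‖ ^ 2 := by
    calc 2 * ∑ y, ∑ x, ‖g x x y‖ ^ 2
        = ∑ x, ∑ y, ∑ z, ((if x = z then ‖g z z y‖ ^ 2 else 0) +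
            (if y = z then ‖g z z x‖ ^ 2 else 0)) := by
          simp only [Finset.sum_add_distrib, Finset.sum_ite_eq, Finset.mem_univ, if_true]
          rw [Finset.sum_comm, two_mul]
      _ ≤ _ := Finset.sum_le_sum fun x _ => Finset.sum_le_sum fun y _ =>
          Finset.sum_le_sum fun z _ => hpt z x y
  calc ∑ y, ‖∑ x, g x x y‖ ^ 2 ≤ ∑ y, ((d : ℝ) - 1) * ∑ x, ‖g x x y‖ ^ 2 :=
        Finset.sum_le_sum fun y _ => hcs y
    _ = ((d : ℝ) - 1) / 2 * (2 * ∑ y, ∑ x, ‖g x x y‖ ^ 2) := by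
        rw [← Finset.mul_sum]
        ring
    _ ≤ _ := by gcongr

lemma pairing_krausKernel_antisymmetric_nonneg :
    0 ≤ (pairing (krausKernel K) (((d : ℂ) - 1) • (tens 1 1 1 - swap₁₂ d) -
      (swap₁₃ d + swap₂₃ d - cycle d - cycleInv d))).re := by
  set g : ZMod d → ZMod d → ZMod d → ℂ := fun z x y => K z x y - K z y x with hgdef
  have hle := sum_norm_partialTrace_le g (fun z x y => by simp [hgdef])
  have h1 : pairing (krausKernel K) (tens 1 1 1 - swap₁₂ d) =
      ((1 / 2 * ∑ x, ∑ y, ∑ z, ‖g z x y‖ ^ 2 : ℝ) : ℂ) := by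
    have hsym : ∑ x, ∑ y, ∑ z, K z x y * star (K z x y) =
        ∑ x, ∑ y, ∑ z, K z y x * star (K z y x) := Finset.sum_comm
    have hsym' : ∑ x, ∑ y, ∑ z, K z x y * star (K z y x) =
        ∑ x, ∑ y, ∑ z, K z y x * star (K z x y) := Finset.sum_comm
    push_cast
    simp only [← Complex.ofReal_pow, ← mul_star_eq_normSq, hgdef, star_sub, sub_mul, mul_sub,
      Finset.sum_sub_distrib]
    rw [LinearMap.map_sub, pairing_krausKernel_one, pairing_krausKernel_swap₁₂, ← hsym, ← hsym']
    ring
  have h2 : pairing (krausKernel K) (swap₁₃ d + swap₂₃ d - cycle d - cycleInv d) =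
      ((∑ y, ‖∑ x, g x x y‖ ^ 2 : ℝ) : ℂ) := by
    push_cast
    simp only [← Complex.ofReal_pow, ← mul_star_eq_normSq, hgdef, Finset.sum_sub_distrib,
      star_sub, sub_mul, mul_sub]
    rw [LinearMap.map_sub, LinearMap.map_sub, LinearMap.map_add, pairing_krausKernel_swap₁₃,
      pairing_krausKernel_swap₂₃, pairing_krausKernel_cycle, pairing_krausKernel_cycleInv]
    ring
  rw [LinearMap.map_sub, LinearMap.map_smul, h1, h2, smul_eq_mul]
  have hcast : ((d : ℂ) - 1) = (((d : ℝ) - 1 : ℝ) : ℂ) := by push_cast; rfl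
  rw [hcast, ← Complex.ofReal_mul, ← Complex.ofReal_sub, Complex.ofReal_re]
  linarith

/-- The entries of `(1/d) ∑_u A^u ⊗ A^u ⊗ A^u`: its partial transpose in the third factor is the
matrix of the permutation `(x₁, x₂, y₃) ↦ (2q - x₁, 2q - x₂, 2q - y₃)` with `q = x₁ + x₂ - y₃`. -/
lemma parityTensor_apply (hd : Odd d) (x₁ y₁ x₂ y₂ x₃ y₃ : ZMod d) :
    parityTensor d x₁ y₁ x₂ y₂ x₃ y₃ =
      if y₁ = x₁ + 2 * x₂ - 2 * y₃ ∧ y₂ = 2 * x₁ + x₂ - 2 * y₃ ∧ x₃ = 2 * x₁ + 2 * x₂ - 3 * y₃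
      then 1 else 0 := by
  have hterm : ∀ p q : ZMod d, tens (pointOp d (p, q)) (pointOp d (p, q)) (pointOp d (p, q))
      x₁ y₁ x₂ y₂ x₃ y₃ = if x₁ + y₁ = 2 * q then
        (if x₂ + y₂ = x₁ + y₁ ∧ x₃ + y₃ = x₁ + y₁ then
          (ZMod.stdAddChar (p * (x₁ - y₁ + (x₂ - y₂) + (x₃ - y₃))) : ℂ) else 0) else 0 := by
    intro p q
    simp only [tens, pointOp_apply hd]
    by_cases h1 : x₁ + y₁ = 2 * q
    · by_cases h2 : x₂ + y₂ = 2 * q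
      · by_cases h3 : x₃ + y₃ = 2 * q
        · simp only [h1, h2, h3, if_true, and_self, ← AddChar.map_add_eq_mul]
          congr 1
          ring
        · simp [h1, h3]
      · simp [h1, h2]
    · simp [h1]
  have hq : ∀ q : ZMod d, x₁ + y₁ = 2 * q ↔ q = half d * (x₁ + y₁) := by
    intro q
    rw [← two_mul_inj hd (x := q)]
    constructor <;> intro h <;> linear_combination -h - (x₁ + y₁) * two_mul_half hd
  have hd0 : (d : ℂ) ≠ 0 := NeZero.ne _
  simp only [parityTensor, Pi.smul_apply, Finset.sum_apply, Fintype.sum_prod_type, hterm, hq,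
    Finset.sum_ite_eq', Finset.mem_univ, if_true, smul_eq_mul]
  by_cases h : x₂ + y₂ = x₁ + y₁ ∧ x₃ + y₃ = x₁ + y₁
  · obtain ⟨h2, h3⟩ := h
    simp only [h2, h3, and_self, if_true, sum_stdAddChar_mul]
    have hiff : x₁ - y₁ + (x₂ - y₂) + (x₃ - y₃) = 0 ↔ y₁ = x₁ + 2 * x₂ - 2 * y₃ ∧
        y₂ = 2 * x₁ + x₂ - 2 * y₃ ∧ x₃ = 2 * x₁ + 2 * x₂ - 3 * y₃ := by
      constructor
      · intro h
        refine ⟨?_, ?_, ?_⟩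
        · linear_combination -h - h2 + h3
        · linear_combination -h + h3
        · linear_combination -h - h2 + 2 * h3
      · rintro ⟨h4, h5, h6⟩
        linear_combination -h4 - h5 + h6
    simp only [hiff]
    split_ifs <;> simp [hd0]
  · have h' : ¬ (y₁ = x₁ + 2 * x₂ - 2 * y₃ ∧ y₂ = 2 * x₁ + x₂ - 2 * y₃ ∧
        x₃ = 2 * x₁ + 2 * x₂ - 3 * y₃) := by
      rintro ⟨h4, h5, h6⟩
      exact h ⟨by linear_combination h5 - h4, by linear_combination h6 - h4⟩
    simp [h, h']

lemma re_mul_star_le (a b : ℂ) : (a * star b).re ≤ (‖a‖ ^ 2 + ‖b‖ ^ 2) / 2 := by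
  simp only [Complex.sq_norm, Complex.normSq_apply, Complex.mul_re, Complex.star_def,
    Complex.conj_re, Complex.conj_im]
  nlinarith [sq_nonneg (a.re - b.re), sq_nonneg (a.im - b.im)]

lemma pairing_krausKernel_parity_nonneg (hd : Odd d) :
    0 ≤ (pairing (krausKernel K) (tens 1 1 1 - parityTensor d)).re := by
  let σ : ZMod d × ZMod d × ZMod d → ZMod d × ZMod d × ZMod d := fun s =>
    (s.1 + 2 * s.2.1 - 2 * s.2.2, 2 * s.1 + s.2.1 - 2 * s.2.2, 2 * s.1 + 2 * s.2.1 - 3 * s.2.2)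
  have hσ : Function.Involutive σ := by
    rintro ⟨x, y, z⟩
    simp only [σ, Prod.mk.injEq]
    refine ⟨?_, ?_, ?_⟩ <;> ring
  let k : ZMod d × ZMod d × ZMod d → ℂ := fun s => K s.2.2 s.1 s.2.1
  have h1 : pairing (krausKernel K) (tens 1 1 1) = ∑ s, k s * star (k s) := by
    rw [pairing_krausKernel_one]
    simp only [Fintype.sum_prod_type, k]
  have h2 : pairing (krausKernel K) (parityTensor d) = ∑ s, k s * star (k (σ s)) := by
    simp only [pairing_apply, krausKernel, parityTensor_apply hd, ite_and, ite_mul, one_mul,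
      zero_mul, Finset.sum_ite_eq', Finset.mem_univ, if_true, Finset.sum_ite_irrel,
      Finset.sum_const_zero, Fintype.sum_prod_type, k, σ]
  have h3 : ∑ s, ‖k (σ s)‖ ^ 2 = ∑ s, ‖k s‖ ^ 2 :=
    Equiv.sum_comp hσ.toPerm fun s => ‖k s‖ ^ 2
  rw [LinearMap.map_sub, h1, h2, Complex.sub_re, Complex.re_sum, Complex.re_sum]
  simp only [mul_star_eq_normSq, Complex.ofReal_re]
  have h4 : ∑ s, (k s * star (k (σ s))).re ≤ ∑ s, (‖k s‖ ^ 2 + ‖k (σ s)‖ ^ 2) / 2 :=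
    Finset.sum_le_sum fun s _ => re_mul_star_le _ _
  rw [← Finset.sum_div, Finset.sum_add_distrib, h3] at h4
  linarith

/-- `tr[E(ψ ⊗ ψ) (1 - ψ)] ≥ 0` for a completely positive map `E`. -/
lemma pairing_krausKernel_pureState_nonneg (ψ : UnitVec d) :
    0 ≤ (pairing (krausKernel K) (tens (pureState ψ) (pureState ψ) (1 - pureState ψ))).re := by
  let φ : ZMod d → ℂ := fun z => ∑ x, ∑ y, ψ.1 x * ψ.1 y * K z x y
  have h1 : pairing (krausKernel K) (tens (pureState ψ) (pureState ψ) 1) =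
      ∑ z, φ z * star (φ z) := by
    calc pairing (krausKernel K) (tens (pureState ψ) (pureState ψ) 1)
        = ∑ x₁, ∑ x₂, ∑ y₃, ∑ y₁, ∑ y₂, ∑ x₃,
          ((ψ.1 x₁ * ψ.1 x₂ * K y₃ x₁ x₂) * star (ψ.1 y₁ * ψ.1 y₂ * K x₃ y₁ y₂)) *
            (1 : Matrix (ZMod d) (ZMod d) ℂ) x₃ y₃ := by
          refine Finset.sum_congr rfl fun x₁ _ => Finset.sum_congr rfl fun x₂ _ =>
            Finset.sum_congr rfl fun y₃ _ => Finset.sum_congr rfl fun y₁ _ =>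
            Finset.sum_congr rfl fun y₂ _ => Finset.sum_congr rfl fun x₃ _ => ?_
          simp only [tens, krausKernel, pureState, Matrix.of_apply, star_mul']
          ring
      _ = ∑ x₁, ∑ x₂, ∑ z, ∑ y₁, ∑ y₂,
          (ψ.1 x₁ * ψ.1 x₂ * K z x₁ x₂) * star (ψ.1 y₁ * ψ.1 y₂ * K z y₁ y₂) := by
          simp only [Matrix.one_apply, mul_ite, mul_one, mul_zero, Finset.sum_ite_eq',
            Finset.mem_univ, if_true]
      _ = ∑ z, ∑ x₁, ∑ x₂, ∑ y₁, ∑ y₂,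
          (ψ.1 x₁ * ψ.1 x₂ * K z x₁ x₂) * star (ψ.1 y₁ * ψ.1 y₂ * K z y₁ y₂) :=
          (Finset.sum_congr rfl fun _ _ => Finset.sum_comm).trans Finset.sum_comm
      _ = _ := by
          refine Finset.sum_congr rfl fun z _ => ?_
          simp only [φ, star_sum]
          rw [Finset.sum_mul]
          refine Finset.sum_congr rfl fun x₁ _ => ?_
          rw [Finset.sum_mul]
          refine Finset.sum_congr rfl fun x₂ _ => ?_
          rw [Finset.mul_sum]
          refine Finset.sum_congr rfl fun y₁ _ => ?_
          rw [Finset.mul_sum]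
  have hφ : ∑ z, star (ψ.1 z) * φ z =
      ∑ x, ∑ y, ∑ z, star (ψ.1 z) * (ψ.1 x * ψ.1 y * K z x y) := by
    simp only [φ, Finset.mul_sum]
    rw [Finset.sum_comm]
    exact Finset.sum_congr rfl fun _ _ => Finset.sum_comm
  have h2 : pairing (krausKernel K) (tens (pureState ψ) (pureState ψ) (pureState ψ)) =
      (∑ z, star (ψ.1 z) * φ z) * star (∑ z, star (ψ.1 z) * φ z) := by
    rw [hφ]
    simp only [star_sum]
    rw [Finset.sum_mul]
    refine Finset.sum_congr rfl fun x₁ _ => ?_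
    rw [Finset.sum_mul]
    refine Finset.sum_congr rfl fun x₂ _ => ?_
    rw [Finset.sum_mul]
    refine Finset.sum_congr rfl fun y₃ _ => ?_
    rw [Finset.mul_sum]
    refine Finset.sum_congr rfl fun y₁ _ => ?_
    rw [Finset.mul_sum]
    refine Finset.sum_congr rfl fun y₂ _ => ?_
    rw [Finset.mul_sum]
    refine Finset.sum_congr rfl fun x₃ _ => ?_
    simp only [tens, krausKernel, pureState, Matrix.of_apply, star_mul', star_star]
    ring
  have h3 : tens (pureState ψ) (pureState ψ) (1 - pureState ψ) =
      tens (pureState ψ) (pureState ψ) 1 - tens (pureState ψ) (pureState ψ) (pureState ψ) := by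
    funext x₁ y₁ x₂ y₂ x₃ y₃
    simp only [tens, Pi.sub_apply, Matrix.sub_apply, mul_sub]
  have hcs : ‖∑ z, star (ψ.1 z) * φ z‖ ^ 2 ≤ ∑ z, ‖φ z‖ ^ 2 := by
    have h := norm_inner_le_norm (𝕜 := ℂ) ψ.1 (WithLp.toLp 2 φ)
    have hψ : ‖ψ.1‖ = 1 := by simp
    have hin : inner ℂ ψ.1 (WithLp.toLp 2 φ) = ∑ z, star (ψ.1 z) * φ z := by
      simp [PiLp.inner_apply, mul_comm]
    rw [hψ, one_mul, hin] at h
    rw [← EuclideanSpace.norm_sq_eq (WithLp.toLp 2 φ)]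
    gcongr
  rw [h3, LinearMap.map_sub, h1, h2]
  simp only [mul_star_eq_normSq]
  rw [← Complex.ofReal_sum, ← Complex.ofReal_sub, Complex.ofReal_re]
  linarith

end Kraus

end Tensors

section WignerPositivity

variable {d : ℕ} [NeZero d]

/-! ### Positivity from Wigner preservation -/

lemma re_pairing_sum_tens_nonneg {J : Tensor d}
    (hJ : ∀ u v w, 0 ≤ (pairing J (tens (pointOp d u) (pointOp d v) (pointOp d w))).re)
    (c : ZMod d × ZMod d → ZMod d × ZMod d → ZMod d × ZMod d → ℝ) (hc : ∀ u v w, 0 ≤ c u v w) :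
    0 ≤ (pairing J (∑ u, ∑ v, ∑ w,
      ((c u v w : ℝ) : ℂ) • tens (pointOp d u) (pointOp d v) (pointOp d w))).re := by
  have h : pairing J (∑ u, ∑ v, ∑ w,
      ((c u v w : ℝ) : ℂ) • tens (pointOp d u) (pointOp d v) (pointOp d w)) =
      ∑ u, ∑ v, ∑ w, ((c u v w : ℝ) : ℂ) *
        pairing J (tens (pointOp d u) (pointOp d v) (pointOp d w)) := by
    rw [pairing_sum]
    refine Finset.sum_congr rfl fun u _ => ?_
    rw [pairing_sum]
    refine Finset.sum_congr rfl fun v _ => ?_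
    rw [pairing_sum]
    refine Finset.sum_congr rfl fun w _ => ?_
    rw [LinearMap.map_smul, smul_eq_mul]
  rw [h, Complex.re_sum]
  refine Finset.sum_nonneg fun u _ => ?_
  rw [Complex.re_sum]
  refine Finset.sum_nonneg fun v _ => ?_
  rw [Complex.re_sum]
  refine Finset.sum_nonneg fun w _ => ?_
  rw [Complex.re_ofReal_mul]
  exact mul_nonneg (hc u v w) (hJ u v w)

lemma sum_triple_mul {ι R : Type*} [Fintype ι] [CommSemiring R] (f g h : ι → R) :
    ∑ u, ∑ v, ∑ w, f u * g v * h w = (∑ u, f u) * (∑ v, g v) * ∑ w, h w := by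
  rw [Finset.sum_mul_sum, Finset.sum_mul]
  refine Finset.sum_congr rfl fun u _ => ?_
  rw [Finset.sum_mul]
  refine Finset.sum_congr rfl fun v _ => ?_
  rw [Finset.mul_sum]

lemma one_mul_one_eq_sum_pointOp (hd : Odd d) (x y z w : ZMod d) :
    (1 : Matrix (ZMod d) (ZMod d) ℂ) x w * (1 : Matrix (ZMod d) (ZMod d) ℂ) z y =
      ∑ u, (d : ℂ)⁻¹ * (pointOp d u x y * pointOp d u z w) := by
  have hd0 : (d : ℂ) ≠ 0 := NeZero.ne _
  rw [← Finset.mul_sum, sum_pointOp_mul_pointOp hd]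
  simp only [Matrix.one_apply, eq_comm (a := z)]
  by_cases h1 : x = w <;> by_cases h2 : y = z <;> simp [h1, h2, hd0]

lemma one_eq_sum_pointOp (hd : Odd d) (x y : ZMod d) :
    (1 : Matrix (ZMod d) (ZMod d) ℂ) x y = ∑ u, (d : ℂ)⁻¹ * pointOp d u x y := by
  have hd0 : (d : ℂ) ≠ 0 := NeZero.ne _
  rw [← Finset.mul_sum, sum_pointOp hd, Matrix.one_apply]
  split_ifs <;> simp [hd0]

lemma sum_rotate {α β γ ι R : Type*} [Fintype α] [Fintype β] [Fintype γ] [Fintype ι]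
    [AddCommMonoid R] (f : α → β → γ → ι → R) :
    ∑ a, ∑ b, ∑ c, ∑ i, f a b c i = ∑ i, ∑ a, ∑ b, ∑ c, f a b c i :=
  (Finset.sum_congr rfl fun _ _ => (Finset.sum_congr rfl fun _ _ => Finset.sum_comm).trans
    Finset.sum_comm).trans Finset.sum_comm

lemma tens_one_eq_sum (hd : Odd d) : tens (1 : Matrix (ZMod d) (ZMod d) ℂ) 1 1 =
    ∑ u, ∑ v, ∑ w, ((d : ℂ)⁻¹ ^ 3) • tens (pointOp d u) (pointOp d v) (pointOp d w) := by
  funext x₁ y₁ x₂ y₂ x₃ y₃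
  simp only [Finset.sum_apply, Pi.smul_apply, tens, smul_eq_mul, one_eq_sum_pointOp hd]
  rw [← sum_triple_mul]
  refine Finset.sum_congr rfl fun u _ => Finset.sum_congr rfl fun v _ =>
    Finset.sum_congr rfl fun w _ => ?_
  ring

lemma cycle_eq_sum (hd : Odd d) : cycle d = ∑ u, ∑ v, ∑ w,
    ((d : ℂ)⁻¹ ^ 3 * tripleTrace u v w) • tens (pointOp d u) (pointOp d v) (pointOp d w) := by
  funext x₁ y₁ x₂ y₂ x₃ y₃
  simp only [Finset.sum_apply, Pi.smul_apply, tens, smul_eq_mul]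
  calc cycle d x₁ y₁ x₂ y₂ x₃ y₃
      = ∑ p, ∑ q, ∑ r, ((1 : Matrix (ZMod d) (ZMod d) ℂ) r y₁ *
            (1 : Matrix (ZMod d) (ZMod d) ℂ) x₁ p) *
          ((1 : Matrix (ZMod d) (ZMod d) ℂ) p y₂ *
            (1 : Matrix (ZMod d) (ZMod d) ℂ) x₂ q) *
          ((1 : Matrix (ZMod d) (ZMod d) ℂ) q y₃ *
            (1 : Matrix (ZMod d) (ZMod d) ℂ) x₃ r) := by
        simp [cycle, Matrix.one_apply, mul_comm]
    _ = ∑ p, ∑ q, ∑ r, ∑ u, ∑ v, ∑ w, (d : ℂ)⁻¹ ^ 3 *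
          (pointOp d u r p * pointOp d v p q * pointOp d w q r) *
          (pointOp d u x₁ y₁ * pointOp d v x₂ y₂ * pointOp d w x₃ y₃) := by
        refine Finset.sum_congr rfl fun p _ => Finset.sum_congr rfl fun q _ =>
          Finset.sum_congr rfl fun r _ => ?_
        simp only [one_mul_one_eq_sum_pointOp hd]
        rw [← sum_triple_mul]
        refine Finset.sum_congr rfl fun u _ => Finset.sum_congr rfl fun v _ =>
          Finset.sum_congr rfl fun w _ => ?_
        ring
    _ = ∑ u, ∑ v, ∑ w, ∑ p, ∑ q, ∑ r, (d : ℂ)⁻¹ ^ 3 *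
          (pointOp d u r p * pointOp d v p q * pointOp d w q r) *
          (pointOp d u x₁ y₁ * pointOp d v x₂ y₂ * pointOp d w x₃ y₃) := by
        rw [sum_rotate]
        refine Finset.sum_congr rfl fun u _ => ?_
        rw [sum_rotate]
        refine Finset.sum_congr rfl fun v _ => ?_
        rw [sum_rotate]
    _ = _ := by
        simp only [tripleTrace, Finset.mul_sum, Finset.sum_mul]

lemma cycleInv_eq_sum (hd : Odd d) : cycleInv d = ∑ u, ∑ v, ∑ w,
    ((d : ℂ)⁻¹ ^ 3 * star (tripleTrace u v w)) •
      tens (pointOp d u) (pointOp d v) (pointOp d w) := by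
  funext x₁ y₁ x₂ y₂ x₃ y₃
  simp only [Finset.sum_apply, Pi.smul_apply, tens, smul_eq_mul]
  calc cycleInv d x₁ y₁ x₂ y₂ x₃ y₃
      = ∑ p, ∑ q, ∑ r, ((1 : Matrix (ZMod d) (ZMod d) ℂ) p y₁ *
            (1 : Matrix (ZMod d) (ZMod d) ℂ) x₁ r) *
          ((1 : Matrix (ZMod d) (ZMod d) ℂ) q y₂ *
            (1 : Matrix (ZMod d) (ZMod d) ℂ) x₂ p) *
          ((1 : Matrix (ZMod d) (ZMod d) ℂ) r y₃ *
            (1 : Matrix (ZMod d) (ZMod d) ℂ) x₃ q) := by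
        simp [cycleInv, Matrix.one_apply, mul_comm]
    _ = ∑ p, ∑ q, ∑ r, ∑ u, ∑ v, ∑ w, (d : ℂ)⁻¹ ^ 3 *
          (pointOp d u p r * pointOp d v q p * pointOp d w r q) *
          (pointOp d u x₁ y₁ * pointOp d v x₂ y₂ * pointOp d w x₃ y₃) := by
        refine Finset.sum_congr rfl fun p _ => Finset.sum_congr rfl fun q _ =>
          Finset.sum_congr rfl fun r _ => ?_
        simp only [one_mul_one_eq_sum_pointOp hd]
        rw [← sum_triple_mul]
        refine Finset.sum_congr rfl fun u _ => Finset.sum_congr rfl fun v _ =>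
          Finset.sum_congr rfl fun w _ => ?_
        ring
    _ = ∑ u, ∑ v, ∑ w, ∑ p, ∑ q, ∑ r, (d : ℂ)⁻¹ ^ 3 *
          (pointOp d u p r * pointOp d v q p * pointOp d w r q) *
          (pointOp d u x₁ y₁ * pointOp d v x₂ y₂ * pointOp d w x₃ y₃) := by
        rw [sum_rotate]
        refine Finset.sum_congr rfl fun u _ => ?_
        rw [sum_rotate]
        refine Finset.sum_congr rfl fun v _ => ?_
        rw [sum_rotate]
    _ = _ := by
        simp only [tripleTrace, star_sum, star_mul', star_pointOp hd, Finset.mul_sum,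
          Finset.sum_mul]

/-- As `|tr[A^u A^v A^w]| ≤ 1`, the operator `2 - C - C†` has a non-negative Wigner function. -/
lemma pairing_two_sub_cycle_nonneg (hd : Odd d) {J : Tensor d}
    (hJ : ∀ u v w, 0 ≤ (pairing J (tens (pointOp d u) (pointOp d v) (pointOp d w))).re) :
    0 ≤ (pairing J ((2 : ℂ) • tens 1 1 1 - cycle d - cycleInv d)).re := by
  have h : (2 : ℂ) • tens 1 1 1 - cycle d - cycleInv d = ∑ u, ∑ v, ∑ w,
      (((d : ℝ)⁻¹ ^ 3 * (2 - 2 * (tripleTrace u v w).re) : ℝ) : ℂ) •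
        tens (pointOp d u) (pointOp d v) (pointOp d w) := by
    rw [tens_one_eq_sum hd, cycle_eq_sum hd, cycleInv_eq_sum hd]
    simp only [Finset.smul_sum, ← Finset.sum_sub_distrib, smul_smul, ← sub_smul]
    refine Finset.sum_congr rfl fun u _ => Finset.sum_congr rfl fun v _ =>
      Finset.sum_congr rfl fun w _ => ?_
    congr 1
    have := Complex.add_conj (tripleTrace u v w)
    rw [Complex.star_def]
    push_cast at this ⊢
    linear_combination -((d : ℂ)⁻¹ ^ 3) * this
  rw [h]
  refine re_pairing_sum_tens_nonneg hJ _ fun u v w => ?_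
  have h1 : (tripleTrace u v w).re ≤ 1 :=
    (Complex.re_le_norm _).trans (norm_tripleTrace_le hd u v w)
  exact mul_nonneg (by positivity) (by linarith)

/-- By inclusion-exclusion, the operator is `(1/d) ∑ A^u ⊗ A^v ⊗ A^w` over `u ≠ w` and `v ≠ w`. -/
lemma pairing_parity_complement_nonneg (hd : Odd d) {J : Tensor d}
    (hJ : ∀ u v w, 0 ≤ (pairing J (tens (pointOp d u) (pointOp d v) (pointOp d w))).re) :
    0 ≤ (pairing J ((d : ℂ) ^ 2 • tens 1 1 1 + parityTensor d -
      (d : ℂ) • (swap₁₃ d + swap₂₃ d))).re := by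
  have h : (d : ℂ) ^ 2 • tens 1 1 1 + parityTensor d - (d : ℂ) • (swap₁₃ d + swap₂₃ d) =
      ∑ u, ∑ v, ∑ w, (((d : ℝ)⁻¹ * (if u = w then 0 else 1) * (if v = w then 0 else 1) : ℝ) : ℂ) •
        tens (pointOp d u) (pointOp d v) (pointOp d w) := by
    have hd0 : (d : ℂ) ≠ 0 := NeZero.ne _
    funext x₁ y₁ x₂ y₂ x₃ y₃
    have hone : ∀ x y : ZMod d, ∑ u, pointOp d u x y =
        d * (1 : Matrix (ZMod d) (ZMod d) ℂ) x y := fun x y => by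
      rw [one_eq_sum_pointOp hd, ← Finset.mul_sum, mul_inv_cancel_left₀ hd0]
    have htwo : ∀ x y z w : ZMod d, ∑ u, pointOp d u x y * pointOp d u z w =
        d * ((1 : Matrix (ZMod d) (ZMod d) ℂ) x w * (1 : Matrix (ZMod d) (ZMod d) ℂ) z y) :=
      fun x y z w => by
        rw [one_mul_one_eq_sum_pointOp hd, ← Finset.mul_sum, mul_inv_cancel_left₀ hd0]
    have hne : ∀ (w : ZMod d × ZMod d) (x y : ZMod d),
        ∑ u, (if u = w then (0 : ℂ) else 1) * pointOp d u x y =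
          d * (1 : Matrix (ZMod d) (ZMod d) ℂ) x y - pointOp d w x y := by
      intro w x y
      have : ∀ u, (if u = w then (0 : ℂ) else 1) * pointOp d u x y =
          pointOp d u x y - if u = w then pointOp d u x y else 0 := by
        intro u
        split_ifs <;> simp
      simp only [this, Finset.sum_sub_distrib, hone, Finset.sum_ite_eq', Finset.mem_univ, if_true]
    have hR : (∑ u, ∑ v, ∑ w,
        (((d : ℝ)⁻¹ * (if u = w then 0 else 1) * (if v = w then 0 else 1) : ℝ) : ℂ) •
          tens (pointOp d u) (pointOp d v) (pointOp d w)) x₁ y₁ x₂ y₂ x₃ y₃ =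
        ∑ w, (d : ℂ)⁻¹ * ((d * (1 : Matrix (ZMod d) (ZMod d) ℂ) x₁ y₁ - pointOp d w x₁ y₁) *
          (d * (1 : Matrix (ZMod d) (ZMod d) ℂ) x₂ y₂ - pointOp d w x₂ y₂) *
            pointOp d w x₃ y₃) := by
      simp only [Finset.sum_apply, Pi.smul_apply, tens, smul_eq_mul, ← hne]
      rw [Finset.sum_congr rfl fun u _ => Finset.sum_comm, Finset.sum_comm]
      refine Finset.sum_congr rfl fun w _ => ?_
      rw [Finset.sum_mul_sum, Finset.sum_mul, Finset.mul_sum]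
      refine Finset.sum_congr rfl fun u _ => ?_
      rw [Finset.sum_mul, Finset.mul_sum]
      refine Finset.sum_congr rfl fun v _ => ?_
      push_cast [apply_ite Complex.ofReal]
      ring
    have hexp : ∀ w : ZMod d × ZMod d, (d : ℂ)⁻¹ *
        ((d * (1 : Matrix (ZMod d) (ZMod d) ℂ) x₁ y₁ - pointOp d w x₁ y₁) *
          (d * (1 : Matrix (ZMod d) (ZMod d) ℂ) x₂ y₂ - pointOp d w x₂ y₂) * pointOp d w x₃ y₃) =
        d * (1 : Matrix (ZMod d) (ZMod d) ℂ) x₁ y₁ * (1 : Matrix (ZMod d) (ZMod d) ℂ) x₂ y₂ *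
            pointOp d w x₃ y₃ -
          (1 : Matrix (ZMod d) (ZMod d) ℂ) x₁ y₁ * (pointOp d w x₂ y₂ * pointOp d w x₃ y₃) -
          (1 : Matrix (ZMod d) (ZMod d) ℂ) x₂ y₂ * (pointOp d w x₁ y₁ * pointOp d w x₃ y₃) +
          (d : ℂ)⁻¹ * (pointOp d w x₁ y₁ * pointOp d w x₂ y₂ * pointOp d w x₃ y₃) := by
      intro w
      field_simp
      ring
    rw [hR]
    simp only [hexp, Finset.sum_add_distrib, Finset.sum_sub_distrib, ← Finset.mul_sum, hone, htwo]
    simp only [parityTensor, tens, swap₁₃, swap₂₃, Pi.add_apply, Pi.sub_apply, Pi.smul_apply,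
      Finset.sum_apply, smul_eq_mul]
    ring
  rw [h]
  refine re_pairing_sum_tens_nonneg hJ _ fun u v w => ?_
  split_ifs <;> simp

end WignerPositivity

/-! ### The Choi operator of a Wigner-preserving map -/

section Choi

variable {d : ℕ}

lemma sum_finTwo {α R : Type*} [Fintype α] [AddCommMonoid R] (f : (Fin 2 → α) → R) :
    ∑ x, f x = ∑ a, ∑ b, f ![a, b] := by
  rw [← Fintype.sum_prod_type']
  exact Fintype.sum_equiv (finTwoArrowEquiv α) _ _ fun x => by
    congr 1
    funext i
    fin_cases i <;> rfl

/-- The tensor product `A ⊗ B` on two copies of `ℂ^d`. -/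
def tensorTwo (A B : Matrix (ZMod d) (ZMod d) ℂ) : Matrix (Fin 2 → ZMod d) (Fin 2 → ZMod d) ℂ :=
  Matrix.of fun x y => A (x 0) (y 0) * B (x 1) (y 1)

lemma tensorPow_two (ρ : Matrix (ZMod d) (ZMod d) ℂ) : tensorPow 2 ρ = tensorTwo ρ ρ := by
  ext x y
  simp [tensorPow, tensorTwo, Fin.prod_univ_two]

variable [NeZero d]
  (E : Matrix (Fin 2 → ZMod d) (Fin 2 → ZMod d) ℂ →ₗ[ℂ] Matrix (ZMod d) (ZMod d) ℂ)

/-- The kernel `⟨y₃| E(|x₁x₂⟩⟨y₁y₂|) |x₃⟩` of a linear map `E`. -/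
def choiKernel : Tensor d := fun x₁ y₁ x₂ y₂ x₃ y₃ =>
  E (Matrix.single ![x₁, x₂] ![y₁, y₂] 1) y₃ x₃

lemma apply_eq_sum_single (M : Matrix (Fin 2 → ZMod d) (Fin 2 → ZMod d) ℂ) (a b : ZMod d) :
    E M a b = ∑ x, ∑ y, M x y * E (Matrix.single x y 1) a b := by
  conv_lhs => rw [Matrix.matrix_eq_sum_single M]
  have h : ∀ x y, Matrix.single x y (M x y) = M x y • Matrix.single x y (1 : ℂ) := fun x y => by
    rw [Matrix.smul_single, smul_eq_mul, mul_one]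
  simp only [map_sum, Matrix.sum_apply, h, map_smul, Matrix.smul_apply, smul_eq_mul]

lemma trace_apply_tensorTwo_mul (A B C : Matrix (ZMod d) (ZMod d) ℂ) :
    (E (tensorTwo A B) * C).trace = pairing (choiKernel E) (tens A B C) := by
  have h : ∀ a b, E (tensorTwo A B) a b = ∑ x₁, ∑ x₂, ∑ y₁, ∑ y₂,
      A x₁ y₁ * B x₂ y₂ * E (Matrix.single ![x₁, x₂] ![y₁, y₂] 1) a b := by
    intro a b
    rw [apply_eq_sum_single, sum_finTwo]
    refine Finset.sum_congr rfl fun x₁ _ => Finset.sum_congr rfl fun x₂ _ => ?_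
    rw [sum_finTwo]
    rfl
  calc (E (tensorTwo A B) * C).trace
      = ∑ y₃, ∑ x₃, ∑ x₁, ∑ x₂, ∑ y₁, ∑ y₂,
          A x₁ y₁ * B x₂ y₂ * C x₃ y₃ * choiKernel E x₁ y₁ x₂ y₂ x₃ y₃ := by
        simp only [Matrix.trace, Matrix.diag_apply, Matrix.mul_apply, h, Finset.sum_mul]
        refine Finset.sum_congr rfl fun y₃ _ => Finset.sum_congr rfl fun x₃ _ =>
          Finset.sum_congr rfl fun x₁ _ => Finset.sum_congr rfl fun x₂ _ =>
          Finset.sum_congr rfl fun y₁ _ => Finset.sum_congr rfl fun y₂ _ => ?_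
        rw [choiKernel]
        ring
    _ = ∑ y₃, ∑ x₁, ∑ x₂, ∑ y₁, ∑ y₂, ∑ x₃,
          A x₁ y₁ * B x₂ y₂ * C x₃ y₃ * choiKernel E x₁ y₁ x₂ y₂ x₃ y₃ := by
        refine Finset.sum_congr rfl fun y₃ _ => ?_
        rw [Finset.sum_comm]
        refine Finset.sum_congr rfl fun x₁ _ => ?_
        rw [Finset.sum_comm]
        refine Finset.sum_congr rfl fun x₂ _ => ?_
        rw [Finset.sum_comm]
        exact Finset.sum_congr rfl fun y₁ _ => Finset.sum_comm
    _ = ∑ x₁, ∑ x₂, ∑ y₃, ∑ y₁, ∑ y₂, ∑ x₃,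
          A x₁ y₁ * B x₂ y₂ * C x₃ y₃ * choiKernel E x₁ y₁ x₂ y₂ x₃ y₃ := by
        rw [Finset.sum_comm]
        exact Finset.sum_congr rfl fun x₁ _ => Finset.sum_comm

/-- The projection onto the maximally entangled state of two copies of a system with basis `ι`. -/
noncomputable def maxEntangled (ι : Type*) [Fintype ι] [DecidableEq ι] :
    Matrix (ι × ι) (ι × ι) ℂ :=
  ((Fintype.card ι : ℝ)⁻¹ : ℂ) •
    Matrix.vecMulVec (fun p => if p.1 = p.2 then 1 else 0)
      (star fun p => if p.1 = p.2 then 1 else 0)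

lemma maxEntangled_apply {ι : Type*} [Fintype ι] [DecidableEq ι] (p q : ι × ι) :
    maxEntangled ι p q =
      if p.1 = p.2 then (if q.1 = q.2 then (Fintype.card ι : ℂ)⁻¹ else 0) else 0 := by
  simp only [maxEntangled, Matrix.smul_apply, Matrix.vecMulVec_apply, Pi.star_apply, smul_eq_mul]
  split_ifs <;> simp

lemma posSemidef_maxEntangled (ι : Type*) [Fintype ι] [DecidableEq ι] :
    (maxEntangled ι).PosSemidef := by
  unfold maxEntangled
  refine (Matrix.posSemidef_vecMulVec_self_star _).smul ?_
  rw [← Complex.ofReal_inv]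
  exact_mod_cast inv_nonneg.2 (Nat.cast_nonneg (Fintype.card ι) : (0 : ℝ) ≤ _)

lemma trace_maxEntangled (ι : Type*) [Fintype ι] [DecidableEq ι] [Nonempty ι] :
    (maxEntangled ι).trace = 1 := by
  have hc : (Fintype.card ι : ℂ) ≠ 0 := by exact_mod_cast Fintype.card_ne_zero
  simp [Matrix.trace, maxEntangled_apply, Fintype.sum_prod_type, hc]

lemma ampliate_maxEntangled (x y : Fin 2 → ZMod d) (a b : ZMod d) :
    ampliate (Fin 2 → ZMod d) E (maxEntangled (Fin 2 → ZMod d)) (x, a) (y, b) =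
      ((d : ℂ) ^ 2)⁻¹ * E (Matrix.single x y 1) a b := by
  have h : (Matrix.of fun i j => maxEntangled (Fin 2 → ZMod d) (x, i) (y, j)) =
      ((d : ℂ) ^ 2)⁻¹ • Matrix.single x y (1 : ℂ) := by
    ext i j
    simp only [maxEntangled_apply, Matrix.of_apply, Matrix.smul_apply, Matrix.single_apply,
      Fintype.card_pi, ZMod.card, Finset.prod_const, Finset.card_univ, Fintype.card_fin,
      Nat.cast_pow, smul_eq_mul, ite_and]
    split_ifs <;> simp
  rw [ampliate, Matrix.of_apply, h, map_smul, Matrix.smul_apply, smul_eq_mul]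

/-- `tr[A^u (A^v)ᵀ] ≥ 0`, as the transpose of a phase-space point operator is another one. -/
lemma sum_pointOp_mul_pointOp_nonneg (hd : Odd d) (u v : ZMod d × ZMod d) :
    0 ≤ ∑ x, ∑ y, pointOp d u x y * pointOp d v x y := by
  have hy : ∀ q x y : ZMod d, x + y = 2 * q ↔ y = 2 * q - x := fun q x y => by
    constructor <;> intro h <;> linear_combination h
  by_cases huv : u.2 = v.2
  · have hterm : ∀ x, ∑ y, pointOp d u x y * pointOp d v x y =
        ZMod.stdAddChar (-(u.1 + v.1) * 2 * u.2) * ZMod.stdAddChar (x * (2 * (u.1 + v.1))) := by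
      intro x
      simp only [pointOp_apply hd, ← huv, hy, ite_mul, zero_mul, Finset.sum_ite_eq',
        Finset.mem_univ, if_true, ← AddChar.map_add_eq_mul]
      congr 1
      ring
    simp only [hterm, ← Finset.mul_sum, sum_stdAddChar_mul]
    by_cases h0 : 2 * (u.1 + v.1) = 0
    · have h1 : u.1 + v.1 = 0 := by
        rw [← two_mul_inj hd, h0, mul_zero]
      simp [h1]
    · simp [h0]
  · refine le_of_eq (Finset.sum_eq_zero fun x _ => Finset.sum_eq_zero fun y _ => ?_).symm
    rw [pointOp_apply hd, pointOp_apply hd]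
    by_cases h1 : x + y = 2 * u.2
    · have h2 : ¬ x + y = 2 * v.2 := fun h2 => huv ((two_mul_inj hd).1 (h1.symm.trans h2))
      simp [h2]
    · simp [h1]

lemma pointOpPi_two_apply (u : Fin 2 → ZMod d × ZMod d) (x y : Fin 2 → ZMod d) :
    pointOpPi (fun _ : Fin 2 => d) u x y =
      pointOp d (u 0) (x 0) (y 0) * pointOp d (u 1) (x 1) (y 1) := by
  simp [pointOpPi, Fin.prod_univ_two]

lemma maxEntangled_mem_wignerPolytope (hd : Odd d) :
    maxEntangled (Fin 2 → ZMod d) ∈ wignerPolytope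
      (pointOpProd (pointOpPi fun _ : Fin 2 => d) (pointOpPi fun _ : Fin 2 => d)) := by
  refine ⟨⟨posSemidef_maxEntangled _, fun w => ?_⟩, trace_maxEntangled _⟩
  obtain ⟨u, v⟩ := w
  have htr : (pointOpProd (pointOpPi fun _ : Fin 2 => d) (pointOpPi fun _ : Fin 2 => d) (u, v) *
      maxEntangled (Fin 2 → ZMod d)).trace = ((d : ℂ) ^ 2)⁻¹ *
        ((∑ x, ∑ y, pointOp d (u 0) x y * pointOp d (v 0) x y) *
          (∑ x, ∑ y, pointOp d (u 1) x y * pointOp d (v 1) x y)) := by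
    have h1 : (pointOpProd (pointOpPi fun _ : Fin 2 => d) (pointOpPi fun _ : Fin 2 => d) (u, v) *
        maxEntangled (Fin 2 → ZMod d)).trace =
        ∑ x, ∑ y, pointOpPi (fun _ : Fin 2 => d) u x y * pointOpPi (fun _ : Fin 2 => d) v x y *
          ((d : ℂ) ^ 2)⁻¹ := by
      simp only [Matrix.trace, Matrix.diag_apply, Matrix.mul_apply, pointOpProd,
        Matrix.kroneckerMap_apply, maxEntangled_apply, Fintype.sum_prod_type, mul_ite, mul_zero,
        Finset.sum_ite_eq, Finset.mem_univ, if_true, Finset.sum_ite_irrel,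
        Finset.sum_const_zero, Fintype.card_pi, ZMod.card, Finset.prod_const, Finset.card_univ,
        Fintype.card_fin, Nat.cast_pow]
    rw [h1]
    simp only [← Finset.sum_mul]
    rw [mul_comm]
    congr 1
    rw [sum_finTwo, Finset.sum_mul_sum]
    refine Finset.sum_congr rfl fun a _ => Finset.sum_congr rfl fun b _ => ?_
    rw [sum_finTwo, Finset.sum_mul_sum]
    refine Finset.sum_congr rfl fun a' _ => Finset.sum_congr rfl fun b' _ => ?_
    rw [pointOpPi_two_apply, pointOpPi_two_apply]
    exact mul_mul_mul_comm _ _ _ _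
  have hnn : 0 ≤ ((Fintype.card ((Fin 2 → ZMod d) × (Fin 2 → ZMod d)) : ℂ))⁻¹ *
      (pointOpProd (pointOpPi fun _ : Fin 2 => d) (pointOpPi fun _ : Fin 2 => d) (u, v) *
        maxEntangled (Fin 2 → ZMod d)).trace := by
    rw [htr]
    have h1 := sum_pointOp_mul_pointOp_nonneg hd (u 0) (v 0)
    have h2 := sum_pointOp_mul_pointOp_nonneg hd (u 1) (v 1)
    have h3 : ∀ n : ℕ, (0 : ℂ) ≤ (n : ℂ)⁻¹ := fun n => by
      rw [← Complex.ofReal_natCast, ← Complex.ofReal_inv]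
      exact_mod_cast inv_nonneg.2 (Nat.cast_nonneg n : (0 : ℝ) ≤ n)
    have h4 := h3 (d ^ 2)
    push_cast at h4
    exact mul_nonneg (h3 _) (mul_nonneg h4 (mul_nonneg h1 h2))
  exact (Complex.nonneg_iff.1 hnn).1

variable {E}

lemma pairing_choiKernel_pointOp_nonneg (hd : Odd d) (hE : IsCPWP d 2 E) (u v w : ZMod d × ZMod d) :
    0 ≤ (pairing (choiKernel E) (tens (pointOp d u) (pointOp d v) (pointOp d w))).re := by
  -- the Choi operator involves the transposes of the phase-space point operators of the inputs
  have h := (hE 2 (fun _ => d) (fun _ => hd) _ (maxEntangled_mem_wignerPolytope hd)).2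
    (![(-u.1, u.2), (-v.1, v.2)], w)
  have htr : (pointOpProd (pointOpPi fun _ : Fin 2 => d) (pointOp d)
      (![(-u.1, u.2), (-v.1, v.2)], w) *
      ampliate (Fin 2 → ZMod d) E (maxEntangled (Fin 2 → ZMod d))).trace =
      ((d : ℂ) ^ 2)⁻¹ *
        pairing (choiKernel E) (tens (pointOp d u) (pointOp d v) (pointOp d w)) := by
    simp only [Matrix.trace, Matrix.diag_apply, Matrix.mul_apply, pointOpProd,
      Matrix.kroneckerMap_apply, Fintype.sum_prod_type, ampliate_maxEntangled]
    simp only [sum_finTwo, pointOpPi_two_apply, Matrix.cons_val_zero, Matrix.cons_val_one,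
      ← pointOp_transpose hd]
    calc _ = ∑ y₁, ∑ y₂, ∑ x₃, ∑ x₁, ∑ x₂, ∑ y₃, ((d : ℂ) ^ 2)⁻¹ *
          (tens (pointOp d u) (pointOp d v) (pointOp d w) x₁ y₁ x₂ y₂ x₃ y₃ *
            choiKernel E x₁ y₁ x₂ y₂ x₃ y₃) := by
          refine Finset.sum_congr rfl fun y₁ _ => Finset.sum_congr rfl fun y₂ _ =>
            Finset.sum_congr rfl fun x₃ _ => Finset.sum_congr rfl fun x₁ _ =>
            Finset.sum_congr rfl fun x₂ _ => Finset.sum_congr rfl fun y₃ _ => ?_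
          rw [tens, choiKernel]
          ring
      _ = ∑ x₁, ∑ x₂, ∑ y₃, ∑ y₁, ∑ y₂, ∑ x₃, ((d : ℂ) ^ 2)⁻¹ *
          (tens (pointOp d u) (pointOp d v) (pointOp d w) x₁ y₁ x₂ y₂ x₃ y₃ *
            choiKernel E x₁ y₁ x₂ y₂ x₃ y₃) := by
          rw [sum_rotate]
          refine Finset.sum_congr rfl fun x₁ _ => ?_
          rw [sum_rotate]
          refine Finset.sum_congr rfl fun x₂ _ => ?_
          rw [sum_rotate]
      _ = _ := by
          simp only [← Finset.mul_sum]
          rfl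
  change 0 ≤ ((Fintype.card ((Fin 2 → ZMod d) × ZMod d) : ℂ)⁻¹ * (pointOpProd
    (pointOpPi fun _ : Fin 2 => d) (pointOp d) (![(-u.1, u.2), (-v.1, v.2)], w) *
      ampliate (Fin 2 → ZMod d) E (maxEntangled (Fin 2 → ZMod d))).trace).re at h
  have hd0 : 0 < (d : ℝ) := Nat.cast_pos.2 (NeZero.pos d)
  have hcast : ((Fintype.card ((Fin 2 → ZMod d) × ZMod d) : ℂ)⁻¹ * ((d : ℂ) ^ 2)⁻¹) =
      ((((d : ℝ) ^ 2 * d)⁻¹ * ((d : ℝ) ^ 2)⁻¹ : ℝ) : ℂ) := by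
    simp [ZMod.card]
  rw [htr, ← mul_assoc, hcast, Complex.re_ofReal_mul] at h
  exact nonneg_of_mul_nonneg_right h (by positivity)

open scoped MatrixOrder in
/-- A Kraus decomposition of a Wigner-preserving map, from factorizing its Choi operator. -/
lemma exists_kraus (hd : Odd d) (hE : IsCPWP d 2 E) :
    ∃ K : (Fin 2 → ZMod d) × ZMod d → ZMod d → ZMod d → ZMod d → ℂ, ∀ M : Tensor d,
      pairing (choiKernel E) M = ∑ r, pairing (krausKernel (K r)) M := by
  have hout := (hE 2 (fun _ => d) (fun _ => hd) _ (maxEntangled_mem_wignerPolytope hd)).1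
  obtain ⟨B, hB⟩ := CStarAlgebra.nonneg_iff_eq_star_mul_self.mp hout.nonneg
  refine ⟨fun r z x₁ x₂ => d * star (B r (![x₁, x₂], z)), fun M => ?_⟩
  have hJ : choiKernel E =
      ∑ r, krausKernel fun z x₁ x₂ => d * star (B r (![x₁, x₂], z)) := by
    funext x₁ y₁ x₂ y₂ x₃ y₃
    have hd0 : (d : ℂ) ≠ 0 := NeZero.ne _
    have h := congrFun (congrFun hB (![x₁, x₂], y₃)) (![y₁, y₂], x₃)
    rw [ampliate_maxEntangled, Matrix.mul_apply] at h
    rw [choiKernel, ← mul_right_inj' (inv_ne_zero (pow_ne_zero 2 hd0)), h]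
    simp only [Finset.sum_apply, Finset.mul_sum, krausKernel]
    refine Finset.sum_congr rfl fun r _ => ?_
    rw [Matrix.star_apply, star_mul', star_star, star_natCast]
    field_simp
  rw [hJ, pairing_comm, pairing_sum]
  exact Finset.sum_congr rfl fun r _ => pairing_comm _ _

end Choi

/-! ### The upper bound on the fidelity -/

section UpperBound

variable {d : ℕ} [NeZero d]

@[fun_prop]
lemma continuous_pureState_apply (x y : ZMod d) :
    Continuous fun ψ : UnitVec d => pureState ψ x y := by
  simp only [pureState, Matrix.of_apply]
  fun_prop

lemma trace_pureState (ψ : UnitVec d) : (pureState ψ).trace = 1 := by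
  simpa [Matrix.trace, pureState] using sum_mul_star_unitVec ψ

lemma depolarize_pureState (δ : ℝ) (ψ : UnitVec d) :
    depolarize d δ (pureState ψ) =
      ((1 - δ : ℝ) : ℂ) • pureState ψ + ((δ / d : ℝ) : ℂ) • 1 := by
  rw [depolarize, trace_pureState]
  push_cast
  rw [mul_one]

lemma integral_pairing (J : Tensor d) (M : UnitVec d → Tensor d)
    (hM : ∀ x₁ y₁ x₂ y₂ x₃ y₃, Continuous fun ψ => M ψ x₁ y₁ x₂ y₂ x₃ y₃) :
    ∫ ψ, pairing J (M ψ) ∂(haarState d) =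
      pairing J (fun x₁ y₁ x₂ y₂ x₃ y₃ => ∫ ψ, M ψ x₁ y₁ x₂ y₂ x₃ y₃ ∂(haarState d)) := by
  simp only [pairing_apply]
  have hc : ∀ x₁ y₁ x₂ y₂ x₃ y₃, Continuous fun ψ =>
      M ψ x₁ y₁ x₂ y₂ x₃ y₃ * J x₁ y₁ x₂ y₂ x₃ y₃ := fun x₁ y₁ x₂ y₂ x₃ y₃ =>
    (hM x₁ y₁ x₂ y₂ x₃ y₃).mul continuous_const
  rw [integral_finsetSum _ fun x₁ _ => integrable_haarState (by fun_prop)]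
  refine Finset.sum_congr rfl fun x₁ _ => ?_
  rw [integral_finsetSum _ fun x₂ _ => integrable_haarState (by fun_prop)]
  refine Finset.sum_congr rfl fun x₂ _ => ?_
  rw [integral_finsetSum _ fun y₃ _ => integrable_haarState (by fun_prop)]
  refine Finset.sum_congr rfl fun y₃ _ => ?_
  rw [integral_finsetSum _ fun y₁ _ => integrable_haarState (by fun_prop)]
  refine Finset.sum_congr rfl fun y₁ _ => ?_
  rw [integral_finsetSum _ fun y₂ _ => integrable_haarState (by fun_prop)]
  refine Finset.sum_congr rfl fun y₂ _ => ?_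
  rw [integral_finsetSum _ fun x₃ _ => integrable_haarState (by fun_prop)]
  exact Finset.sum_congr rfl fun x₃ _ => integral_mul_const _ _

lemma continuous_pairing (J : Tensor d) (M : UnitVec d → Tensor d)
    (hM : ∀ x₁ y₁ x₂ y₂ x₃ y₃, Continuous fun ψ => M ψ x₁ y₁ x₂ y₂ x₃ y₃) :
    Continuous fun ψ => pairing J (M ψ) := by
  simp only [pairing_apply]
  fun_prop

/-- The part of `D_δ(ψ) ⊗ D_δ(ψ) ⊗ (f - ψ)` of first order in the noise, up to a multiple of
`ψ ⊗ ψ ⊗ (1 - ψ)`. -/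
def firstOrderTensor (ψ : UnitVec d) : Tensor d :=
  tens (pureState ψ) 1 1 + tens 1 (pureState ψ) 1 - tens (pureState ψ) 1 (pureState ψ) -
    tens 1 (pureState ψ) (pureState ψ) - ((d : ℂ) - 1) • tens (pureState ψ) (pureState ψ) 1

/-- The part of `D_δ(ψ) ⊗ D_δ(ψ) ⊗ (f - ψ)` of second order in the noise. -/
def secondOrderTensor (ψ : UnitVec d) : Tensor d :=
  tens (pureState ψ) 1 1 + tens 1 (pureState ψ) 1 + tens 1 1 1 - tens 1 1 (pureState ψ) -
    (d : ℂ) • (tens (pureState ψ) 1 (pureState ψ) + tens 1 (pureState ψ) (pureState ψ))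

/-- The part of `D_δ(ψ) ⊗ D_δ(ψ) ⊗ (f - ψ)` of third order in the noise. -/
def thirdOrderTensor (ψ : UnitVec d) : Tensor d :=
  tens 1 1 1 - (d : ℂ) • tens 1 1 (pureState ψ)

lemma tens_depolarize_eq {s t : ℂ} (hst : s + d * t = 1) (ψ : UnitVec d) :
    tens (s • pureState ψ + t • 1) (s • pureState ψ + t • 1) ((s + t) • 1 - pureState ψ) =
      (s ^ 2) • tens (pureState ψ) (pureState ψ) (1 - pureState ψ) +
      ((s ^ 2 * t) • firstOrderTensor ψ + (s * t ^ 2) • secondOrderTensor ψ +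
        (t ^ 3) • thirdOrderTensor ψ) := by
  funext x₁ y₁ x₂ y₂ x₃ y₃
  simp only [firstOrderTensor, secondOrderTensor, thirdOrderTensor, tens, Pi.add_apply,
    Pi.sub_apply, Pi.smul_apply, Matrix.add_apply, Matrix.sub_apply, Matrix.smul_apply,
    smul_eq_mul]
  generalize pureState ψ x₁ y₁ = a
  generalize pureState ψ x₂ y₂ = b
  generalize pureState ψ x₃ y₃ = c
  generalize (1 : Matrix (ZMod d) (ZMod d) ℂ) x₁ y₁ = e₁
  generalize (1 : Matrix (ZMod d) (ZMod d) ℂ) x₂ y₂ = e₂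
  generalize (1 : Matrix (ZMod d) (ZMod d) ℂ) x₃ y₃ = e₃
  linear_combination (s ^ 2 * a * b * e₃ + s * t * c * (a * e₂ + e₁ * b) +
    t ^ 2 * e₁ * e₂ * c) * hst

lemma integral_pureState (x y : ZMod d) :
    ∫ ψ : UnitVec d, pureState ψ x y ∂(haarState d) =
      (1 : Matrix (ZMod d) (ZMod d) ℂ) x y / d := by
  rw [Matrix.one_apply, ← integral_secondMoment]
  rfl

lemma integral_pureState_mul (x y z w : ZMod d) :
    ∫ ψ : UnitVec d, pureState ψ x y * pureState ψ z w ∂(haarState d) =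
      ((1 : Matrix (ZMod d) (ZMod d) ℂ) x y * (1 : Matrix (ZMod d) (ZMod d) ℂ) z w +
        (1 : Matrix (ZMod d) (ZMod d) ℂ) x w * (1 : Matrix (ZMod d) (ZMod d) ℂ) z y) /
          ((d : ℂ) * (d + 1)) := by
  have h : ∀ p q : Prop, [Decidable p] → [Decidable q] →
      (if p ∧ q then (1 : ℂ) else 0) = (if p then 1 else 0) * (if q then 1 else 0) := by
    intro p q _ _
    by_cases hp : p <;> by_cases hq : q <;> simp [hp, hq]
  simp only [Matrix.one_apply, ← h]
  exact integral_fourthMoment x y z w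

lemma integral_pureState_combination (α β κ γ ε ζ η : ℂ) (x₁ y₁ x₂ y₂ x₃ y₃ : ZMod d) :
    ∫ ψ : UnitVec d, (α * pureState ψ x₁ y₁ + β * pureState ψ x₂ y₂ + κ * pureState ψ x₃ y₃ +
      γ * (pureState ψ x₁ y₁ * pureState ψ x₃ y₃) + ε * (pureState ψ x₂ y₂ * pureState ψ x₃ y₃) +
      ζ * (pureState ψ x₁ y₁ * pureState ψ x₂ y₂) + η) ∂(haarState d) =
    α * ∫ ψ : UnitVec d, pureState ψ x₁ y₁ ∂(haarState d) +
      β * ∫ ψ : UnitVec d, pureState ψ x₂ y₂ ∂(haarState d) +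
      κ * ∫ ψ : UnitVec d, pureState ψ x₃ y₃ ∂(haarState d) +
      γ * ∫ ψ : UnitVec d, pureState ψ x₁ y₁ * pureState ψ x₃ y₃ ∂(haarState d) +
      ε * ∫ ψ : UnitVec d, pureState ψ x₂ y₂ * pureState ψ x₃ y₃ ∂(haarState d) +
      ζ * ∫ ψ : UnitVec d, pureState ψ x₁ y₁ * pureState ψ x₂ y₂ ∂(haarState d) + η := by
  rw [integral_add, integral_add, integral_add, integral_add, integral_add, integral_add]
  · simp only [integral_const_mul, integral_const, probReal_univ, one_smul]
  all_goals exact integrable_haarState (by fun_prop)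

lemma continuous_firstOrderTensor (x₁ y₁ x₂ y₂ x₃ y₃ : ZMod d) :
    Continuous fun ψ : UnitVec d => firstOrderTensor ψ x₁ y₁ x₂ y₂ x₃ y₃ := by
  simp only [firstOrderTensor, tens, Pi.add_apply, Pi.sub_apply, Pi.smul_apply, smul_eq_mul]
  fun_prop

lemma continuous_secondOrderTensor (x₁ y₁ x₂ y₂ x₃ y₃ : ZMod d) :
    Continuous fun ψ : UnitVec d => secondOrderTensor ψ x₁ y₁ x₂ y₂ x₃ y₃ := by
  simp only [secondOrderTensor, tens, Pi.add_apply, Pi.sub_apply, Pi.smul_apply, smul_eq_mul]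
  fun_prop

lemma continuous_thirdOrderTensor (x₁ y₁ x₂ y₂ x₃ y₃ : ZMod d) :
    Continuous fun ψ : UnitVec d => thirdOrderTensor ψ x₁ y₁ x₂ y₂ x₃ y₃ := by
  simp only [thirdOrderTensor, tens, Pi.sub_apply, Pi.smul_apply, smul_eq_mul]
  fun_prop

lemma integral_firstOrderTensor :
    (fun x₁ y₁ x₂ y₂ x₃ y₃ => ∫ ψ, firstOrderTensor ψ x₁ y₁ x₂ y₂ x₃ y₃ ∂(haarState d)) =
      ((d : ℂ) * (d + 1))⁻¹ • ((((d : ℂ) - 1) • (tens 1 1 1 - swap₁₂ d) -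
        (swap₁₃ d + swap₂₃ d - cycle d - cycleInv d)) +
        ((2 : ℂ) • tens 1 1 1 - cycle d - cycleInv d)) := by
  have hd0 : (d : ℂ) ≠ 0 := NeZero.ne _
  have hd1 : (d : ℂ) + 1 ≠ 0 := by exact_mod_cast Nat.succ_ne_zero d
  funext x₁ y₁ x₂ y₂ x₃ y₃
  have h := integral_pureState_combination
    ((1 : Matrix (ZMod d) (ZMod d) ℂ) x₂ y₂ * (1 : Matrix (ZMod d) (ZMod d) ℂ) x₃ y₃)
    ((1 : Matrix (ZMod d) (ZMod d) ℂ) x₁ y₁ * (1 : Matrix (ZMod d) (ZMod d) ℂ) x₃ y₃) 0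
    (-(1 : Matrix (ZMod d) (ZMod d) ℂ) x₂ y₂) (-(1 : Matrix (ZMod d) (ZMod d) ℂ) x₁ y₁)
    (-((d : ℂ) - 1) * (1 : Matrix (ZMod d) (ZMod d) ℂ) x₃ y₃) 0 x₁ y₁ x₂ y₂ x₃ y₃
  simp only [integral_pureState, integral_pureState_mul] at h
  refine Eq.trans (integral_congr_ae (Filter.Eventually.of_forall fun ψ => ?_)) (h.trans ?_)
  · simp only [firstOrderTensor, tens, Pi.add_apply, Pi.sub_apply, Pi.smul_apply, smul_eq_mul]
    ring
  · simp only [tens, swap₁₂, swap₁₃, swap₂₃, Pi.add_apply, Pi.sub_apply, Pi.smul_apply,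
      smul_eq_mul]
    field_simp
    ring

lemma integral_secondOrderTensor :
    (fun x₁ y₁ x₂ y₂ x₃ y₃ => ∫ ψ, secondOrderTensor ψ x₁ y₁ x₂ y₂ x₃ y₃ ∂(haarState d)) =
      ((d : ℂ) * (d + 1))⁻¹ • ((tens 1 1 1 - parityTensor d) +
        ((d : ℂ) ^ 2 • tens 1 1 1 + parityTensor d - (d : ℂ) • (swap₁₃ d + swap₂₃ d))) := by
  have hd0 : (d : ℂ) ≠ 0 := NeZero.ne _
  have hd1 : (d : ℂ) + 1 ≠ 0 := by exact_mod_cast Nat.succ_ne_zero d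
  funext x₁ y₁ x₂ y₂ x₃ y₃
  have h := integral_pureState_combination
    ((1 : Matrix (ZMod d) (ZMod d) ℂ) x₂ y₂ * (1 : Matrix (ZMod d) (ZMod d) ℂ) x₃ y₃)
    ((1 : Matrix (ZMod d) (ZMod d) ℂ) x₁ y₁ * (1 : Matrix (ZMod d) (ZMod d) ℂ) x₃ y₃)
    (-((1 : Matrix (ZMod d) (ZMod d) ℂ) x₁ y₁ * (1 : Matrix (ZMod d) (ZMod d) ℂ) x₂ y₂))
    (-(d : ℂ) * (1 : Matrix (ZMod d) (ZMod d) ℂ) x₂ y₂)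
    (-(d : ℂ) * (1 : Matrix (ZMod d) (ZMod d) ℂ) x₁ y₁) 0
    ((1 : Matrix (ZMod d) (ZMod d) ℂ) x₁ y₁ * (1 : Matrix (ZMod d) (ZMod d) ℂ) x₂ y₂ *
      (1 : Matrix (ZMod d) (ZMod d) ℂ) x₃ y₃) x₁ y₁ x₂ y₂ x₃ y₃
  simp only [integral_pureState, integral_pureState_mul] at h
  refine Eq.trans (integral_congr_ae (Filter.Eventually.of_forall fun ψ => ?_)) (h.trans ?_)
  · simp only [secondOrderTensor, tens, Pi.add_apply, Pi.sub_apply, Pi.smul_apply, smul_eq_mul]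
    ring
  · simp only [tens, swap₁₃, swap₂₃, Pi.add_apply, Pi.sub_apply, Pi.smul_apply, smul_eq_mul]
    field_simp
    ring

lemma integral_thirdOrderTensor :
    (fun x₁ y₁ x₂ y₂ x₃ y₃ => ∫ ψ, thirdOrderTensor ψ x₁ y₁ x₂ y₂ x₃ y₃ ∂(haarState d)) = 0 := by
  have hd0 : (d : ℂ) ≠ 0 := NeZero.ne _
  funext x₁ y₁ x₂ y₂ x₃ y₃
  have h := integral_pureState_combination 0 0
    (-(d : ℂ) * ((1 : Matrix (ZMod d) (ZMod d) ℂ) x₁ y₁ *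
      (1 : Matrix (ZMod d) (ZMod d) ℂ) x₂ y₂)) 0 0 0
    ((1 : Matrix (ZMod d) (ZMod d) ℂ) x₁ y₁ * (1 : Matrix (ZMod d) (ZMod d) ℂ) x₂ y₂ *
      (1 : Matrix (ZMod d) (ZMod d) ℂ) x₃ y₃) x₁ y₁ x₂ y₂ x₃ y₃
  simp only [integral_pureState, integral_pureState_mul] at h
  refine Eq.trans (integral_congr_ae (Filter.Eventually.of_forall fun ψ => ?_)) (h.trans ?_)
  · simp only [thirdOrderTensor, tens, Pi.sub_apply, Pi.smul_apply, smul_eq_mul]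
    ring
  · simp only [Pi.zero_apply]
    field_simp
    ring

variable {E : Matrix (Fin 2 → ZMod d) (Fin 2 → ZMod d) ℂ →ₗ[ℂ] Matrix (ZMod d) (ZMod d) ℂ}

lemma re_integral_pairing (J : Tensor d) (M : UnitVec d → Tensor d)
    (hM : ∀ x₁ y₁ x₂ y₂ x₃ y₃, Continuous fun ψ => M ψ x₁ y₁ x₂ y₂ x₃ y₃) :
    ∫ ψ, (pairing J (M ψ)).re ∂(haarState d) =
      (pairing J (fun x₁ y₁ x₂ y₂ x₃ y₃ => ∫ ψ, M ψ x₁ y₁ x₂ y₂ x₃ y₃ ∂(haarState d))).re := by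
  rw [← integral_pairing J M hM]
  exact integral_re (integrable_haarState (continuous_pairing J M hM))

lemma integral_firstOrderTensor_nonneg (hd : Odd d) (hE : IsCPWP d 2 E) :
    0 ≤ ∫ ψ, (pairing (choiKernel E) (firstOrderTensor ψ)).re ∂(haarState d) := by
  obtain ⟨K, hK⟩ := exists_kraus hd hE
  rw [re_integral_pairing _ _ continuous_firstOrderTensor, integral_firstOrderTensor,
    LinearMap.map_smul, LinearMap.map_add, smul_eq_mul]
  have hc : ((d : ℂ) * (d + 1))⁻¹ = (((d : ℝ) * (d + 1))⁻¹ : ℝ) := by push_cast; rfl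
  rw [hc, Complex.re_ofReal_mul, Complex.add_re]
  refine mul_nonneg (by positivity) (add_nonneg ?_
    (pairing_two_sub_cycle_nonneg hd (pairing_choiKernel_pointOp_nonneg hd hE)))
  rw [hK, Complex.re_sum]
  exact Finset.sum_nonneg fun r _ => pairing_krausKernel_antisymmetric_nonneg (K r)

lemma integral_secondOrderTensor_nonneg (hd : Odd d) (hE : IsCPWP d 2 E) :
    0 ≤ ∫ ψ, (pairing (choiKernel E) (secondOrderTensor ψ)).re ∂(haarState d) := by
  obtain ⟨K, hK⟩ := exists_kraus hd hE
  rw [re_integral_pairing _ _ continuous_secondOrderTensor, integral_secondOrderTensor,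
    LinearMap.map_smul, LinearMap.map_add, smul_eq_mul]
  have hc : ((d : ℂ) * (d + 1))⁻¹ = (((d : ℝ) * (d + 1))⁻¹ : ℝ) := by push_cast; rfl
  rw [hc, Complex.re_ofReal_mul, Complex.add_re]
  refine mul_nonneg (by positivity) (add_nonneg ?_
    (pairing_parity_complement_nonneg hd (pairing_choiKernel_pointOp_nonneg hd hE)))
  rw [hK, Complex.re_sum]
  exact Finset.sum_nonneg fun r _ => pairing_krausKernel_parity_nonneg (K r) hd

lemma integral_thirdOrderTensor_eq_zero :
    ∫ ψ, (pairing (choiKernel E) (thirdOrderTensor ψ)).re ∂(haarState d) = 0 := by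
  rw [re_integral_pairing _ _ continuous_thirdOrderTensor, integral_thirdOrderTensor,
    LinearMap.map_zero, Complex.zero_re]

lemma inputFidelity_eq (δ : ℝ) : inputFidelity d δ = 1 - δ + δ / d := by
  have h : ∀ ψ : UnitVec d,
      (depolarize d δ (pureState ψ) * pureState ψ).trace.re = 1 - δ + δ / d := by
    intro ψ
    have hsq : pureState ψ * pureState ψ = pureState ψ := by
      ext x y
      simp only [Matrix.mul_apply, pureState, Matrix.of_apply]
      calc _ = ψ.1 x * star (ψ.1 y) * ∑ z, ψ.1 z * star (ψ.1 z) := by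
            rw [Finset.mul_sum]
            exact Finset.sum_congr rfl fun z _ => by ring
        _ = _ := by rw [sum_mul_star_unitVec, mul_one]
    rw [depolarize_pureState, add_mul, Matrix.smul_mul, Matrix.smul_mul, one_mul, hsq,
      Matrix.trace_add, Matrix.trace_smul, Matrix.trace_smul, trace_pureState, smul_eq_mul,
      smul_eq_mul, mul_one, mul_one, ← Complex.ofReal_add, Complex.ofReal_re]
  simp only [inputFidelity, h, integral_const, probReal_univ, one_smul]

/-- The overlap of the output with the ideal state is at most `f = 1 - δ + δ/d` times the success
probability. -/
lemma outputOverlap_le (hd : Odd d) {δ : ℝ} (hδ0 : 0 ≤ δ) (hδ1 : δ ≤ 1) (hE : IsCPWP d 2 E) :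
    outputOverlap δ E ≤ (1 - δ + δ / d) * successProb δ E := by
  obtain ⟨K, hK⟩ := exists_kraus hd hE
  set s : ℝ := 1 - δ with hs
  set t : ℝ := δ / d with ht
  have hd0 : (d : ℝ) ≠ 0 := NeZero.ne _
  have hs0 : 0 ≤ s := by linarith
  have ht0 : 0 ≤ t := by positivity
  have hst : (s : ℂ) + d * (t : ℂ) = 1 := by
    rw [hs, ht]
    have : (d : ℝ) * (δ / d) = δ := by field_simp
    exact_mod_cast (by rw [this]; ring : 1 - δ + d * (δ / d) = 1)
  let D : UnitVec d → Matrix (ZMod d) (ZMod d) ℂ := fun ψ => (s : ℂ) • pureState ψ + (t : ℂ) • 1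
  have hD : ∀ ψ, outputState δ E ψ = E (tensorTwo (D ψ) (D ψ)) := fun ψ => by
    rw [outputState, tensorPow_two, depolarize_pureState]
  have hDc : ∀ x y, Continuous fun ψ => D ψ x y := fun x y => by
    simp only [D, Matrix.add_apply, Matrix.smul_apply, smul_eq_mul]
    fun_prop
  have hp : successProb δ E =
      ∫ ψ, (pairing (choiKernel E) (tens (D ψ) (D ψ) 1)).re ∂(haarState d) := by
    simp only [successProb, hD, ← trace_apply_tensorTwo_mul, mul_one]
  have ho : outputOverlap δ E =
      ∫ ψ, (pairing (choiKernel E) (tens (D ψ) (D ψ) (pureState ψ))).re ∂(haarState d) := by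
    simp only [outputOverlap, hD, ← trace_apply_tensorTwo_mul]
  have hcont : ∀ M : UnitVec d → Tensor d,
      (∀ x₁ y₁ x₂ y₂ x₃ y₃, Continuous fun ψ => M ψ x₁ y₁ x₂ y₂ x₃ y₃) →
      Integrable (fun ψ => (pairing (choiKernel E) (M ψ)).re) (haarState d) := fun M hM =>
    integrable_haarState (Complex.continuous_re.comp (continuous_pairing _ M hM))
  have hi1 := hcont (fun ψ => tens (D ψ) (D ψ) 1) fun x₁ y₁ x₂ y₂ x₃ y₃ => by
    simp only [tens]
    fun_prop
  have hi2 := hcont (fun ψ => tens (D ψ) (D ψ) (pureState ψ)) fun x₁ y₁ x₂ y₂ x₃ y₃ => by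
    simp only [tens]
    fun_prop
  have hj1 := hcont _ continuous_firstOrderTensor
  have hj2 := hcont _ continuous_secondOrderTensor
  have hj3 := hcont _ continuous_thirdOrderTensor
  have hpt : ∀ ψ, s ^ 2 * t * (pairing (choiKernel E) (firstOrderTensor ψ)).re +
      s * t ^ 2 * (pairing (choiKernel E) (secondOrderTensor ψ)).re +
      t ^ 3 * (pairing (choiKernel E) (thirdOrderTensor ψ)).re ≤
      (s + t) * (pairing (choiKernel E) (tens (D ψ) (D ψ) 1)).re -
        (pairing (choiKernel E) (tens (D ψ) (D ψ) (pureState ψ))).re := by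
    intro ψ
    have hsplit : ((s + t : ℝ) : ℂ) • tens (D ψ) (D ψ) 1 - tens (D ψ) (D ψ) (pureState ψ) =
        ((s ^ 2 : ℝ) : ℂ) • tens (pureState ψ) (pureState ψ) (1 - pureState ψ) +
        (((s ^ 2 * t : ℝ) : ℂ) • firstOrderTensor ψ + ((s * t ^ 2 : ℝ) : ℂ) • secondOrderTensor ψ +
          ((t ^ 3 : ℝ) : ℂ) • thirdOrderTensor ψ) := by
      push_cast
      rw [← tens_depolarize_eq hst ψ]
      funext x₁ y₁ x₂ y₂ x₃ y₃
      simp only [tens, D, Pi.sub_apply, Pi.smul_apply, Matrix.sub_apply, Matrix.smul_apply,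
        smul_eq_mul]
      ring
    have h := congrArg (fun M => (pairing (choiKernel E) M).re) hsplit
    simp only [LinearMap.map_sub, LinearMap.map_add, LinearMap.map_smul, smul_eq_mul,
      Complex.sub_re, Complex.add_re, Complex.re_ofReal_mul] at h
    rw [h]
    have hpos : 0 ≤ (pairing (choiKernel E)
        (tens (pureState ψ) (pureState ψ) (1 - pureState ψ))).re := by
      rw [hK, Complex.re_sum]
      exact Finset.sum_nonneg fun r _ => pairing_krausKernel_pureState_nonneg (K r) ψ
    have := mul_nonneg (sq_nonneg s) hpos
    linarith
  have hint := integral_mono (((hj1.const_mul (s ^ 2 * t)).add (hj2.const_mul (s * t ^ 2))).add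
    (hj3.const_mul (t ^ 3))) ((hi1.const_mul (s + t)).sub hi2) hpt
  simp only [Pi.add_apply, Pi.sub_apply] at hint
  rw [integral_sub (hi1.const_mul _) hi2, integral_const_mul, ← hp, ← ho,
    integral_add (by exact (hj1.const_mul _).add (hj2.const_mul _)) (hj3.const_mul _),
    integral_add (hj1.const_mul _) (hj2.const_mul _), integral_const_mul, integral_const_mul,
    integral_const_mul, integral_thirdOrderTensor_eq_zero] at hint
  have h1 := mul_nonneg (mul_nonneg (sq_nonneg s) ht0) (integral_firstOrderTensor_nonneg hd hE)
  have h2 := mul_nonneg (mul_nonneg hs0 (sq_nonneg t)) (integral_secondOrderTensor_nonneg hd hE)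
  linarith

end UpperBound

/-! ### Discarding the second copy -/

section Discard

variable {d : ℕ}

/-- The protocol that discards the second copy and accepts with probability `p`. -/
noncomputable def discardSecond (d : ℕ) [NeZero d] (p : ℝ) :
    Matrix (Fin 2 → ZMod d) (Fin 2 → ZMod d) ℂ →ₗ[ℂ] Matrix (ZMod d) (ZMod d) ℂ where
  toFun M := (p : ℂ) • ∑ c, M.submatrix (fun a => ![a, c]) (fun a => ![a, c])
  map_add' M N := by
    simp only [Matrix.submatrix_add, Pi.add_apply, Finset.sum_add_distrib, smul_add]
  map_smul' r M := by
    simp only [Matrix.submatrix_smul, Pi.smul_apply, ← Finset.smul_sum, RingHom.id_apply]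
    rw [smul_comm]

variable [NeZero d] {p : ℝ}

lemma discardSecond_apply (M : Matrix (Fin 2 → ZMod d) (Fin 2 → ZMod d) ℂ) (a b : ZMod d) :
    discardSecond d p M a b = p * ∑ c, M ![a, c] ![b, c] := by
  simp [discardSecond, Matrix.sum_apply]

lemma ampliate_discardSecond {R : Type*}
    (M : Matrix (R × (Fin 2 → ZMod d)) (R × (Fin 2 → ZMod d)) ℂ) :
    ampliate R (discardSecond d p) M = (p : ℂ) •
      ∑ c, M.submatrix (fun x : R × ZMod d => (x.1, ![x.2, c])) (fun x => (x.1, ![x.2, c])) := by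
  ext x y
  simp [ampliate, discardSecond_apply, Matrix.sum_apply]

lemma posSemidef_ampliate_discardSecond (hp : 0 ≤ p) {R : Type*} [Finite R]
    {M : Matrix (R × (Fin 2 → ZMod d)) (R × (Fin 2 → ZMod d)) ℂ} (hM : M.PosSemidef) :
    (ampliate R (discardSecond d p) M).PosSemidef := by
  rw [ampliate_discardSecond]
  refine (Matrix.posSemidef_sum _ fun c _ => hM.submatrix _).smul ?_
  exact_mod_cast hp

lemma trace_discardSecond (M : Matrix (Fin 2 → ZMod d) (Fin 2 → ZMod d) ℂ) :
    (discardSecond d p M).trace = p * M.trace := by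
  simp only [Matrix.trace, Matrix.diag_apply, discardSecond_apply, ← Finset.mul_sum]
  rw [sum_finTwo]

lemma isCPTN_discardSecond (hp : 0 ≤ p) (hp1 : p ≤ 1) : IsCPTN (discardSecond d p) where
  completelyPositive _ _ hM := posSemidef_ampliate_discardSecond hp hM
  trace_le M hM := by
    rw [trace_discardSecond, Complex.re_ofReal_mul]
    have h := (Complex.nonneg_iff.1 hM.trace_nonneg).1
    nlinarith

/-- The Wigner function of a marginal is the marginal of the Wigner function. -/
lemma wigner_ampliate_discardSecond (hd : Odd d) {R U : Type*} [Fintype R]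
    (A : U → Matrix R R ℂ) (M : Matrix (R × (Fin 2 → ZMod d)) (R × (Fin 2 → ZMod d)) ℂ)
    (u : U) (v : ZMod d × ZMod d) :
    wigner (pointOpProd A (pointOp d)) (ampliate R (discardSecond d p) M) (u, v) =
      p * ∑ w, wigner (pointOpProd A (pointOpPi fun _ : Fin 2 => d)) M (u, ![v, w]) := by
  have hd0 : (d : ℂ) ≠ 0 := NeZero.ne _
  have h : ∑ w, (pointOpProd A (pointOpPi fun _ : Fin 2 => d) (u, ![v, w]) * M).trace =
      d * ∑ x, ∑ a, ∑ y, ∑ b, A u x y * pointOp d v a b * ∑ c, M (y, ![b, c]) (x, ![a, c]) := by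
    calc _ = ∑ w, ∑ x, ∑ a, ∑ c, ∑ y, ∑ b, ∑ c', A u x y * (pointOp d v a b * pointOp d w c c') *
          M (y, ![b, c']) (x, ![a, c]) := by
          simp only [Matrix.trace, Matrix.diag_apply, Matrix.mul_apply, pointOpProd,
            Matrix.kroneckerMap_apply, Fintype.sum_prod_type, sum_finTwo, pointOpPi_two_apply,
            Matrix.cons_val_zero, Matrix.cons_val_one]
      _ = ∑ x, ∑ a, ∑ c, ∑ y, ∑ b, ∑ c', ∑ w, A u x y * (pointOp d v a b * pointOp d w c c') *
          M (y, ![b, c']) (x, ![a, c]) := by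
          rw [← sum_rotate]
          refine Finset.sum_congr rfl fun x _ => Finset.sum_congr rfl fun a _ =>
            Finset.sum_congr rfl fun c _ => ?_
          rw [← sum_rotate]
      _ = ∑ x, ∑ a, ∑ c, ∑ y, ∑ b,
          d * (A u x y * pointOp d v a b * M (y, ![b, c]) (x, ![a, c])) := by
          refine Finset.sum_congr rfl fun x _ => Finset.sum_congr rfl fun a _ =>
            Finset.sum_congr rfl fun c _ => Finset.sum_congr rfl fun y _ =>
            Finset.sum_congr rfl fun b _ => ?_
          simp only [← Finset.sum_mul, ← Finset.mul_sum, sum_pointOp hd, mul_ite, ite_mul,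
            mul_zero, zero_mul, Finset.sum_ite_eq, Finset.mem_univ, if_true]
          ring
      _ = _ := by
          simp only [Finset.mul_sum]
          refine Finset.sum_congr rfl fun x _ => Finset.sum_congr rfl fun a _ => ?_
          rw [Finset.sum_comm]
          exact Finset.sum_congr rfl fun y _ => Finset.sum_comm
  have h2 : (pointOpProd A (pointOp d) (u, v) * ampliate R (discardSecond d p) M).trace =
      p * ∑ x, ∑ a, ∑ y, ∑ b, A u x y * pointOp d v a b * ∑ c, M (y, ![b, c]) (x, ![a, c]) := by
    simp only [Matrix.trace, Matrix.diag_apply, Matrix.mul_apply, pointOpProd,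
      Matrix.kroneckerMap_apply, Fintype.sum_prod_type, ampliate, Matrix.of_apply,
      discardSecond_apply, Finset.mul_sum]
    refine Finset.sum_congr rfl fun x _ => Finset.sum_congr rfl fun a _ =>
      Finset.sum_congr rfl fun y _ => Finset.sum_congr rfl fun b _ =>
      Finset.sum_congr rfl fun c _ => ?_
    ring
  simp only [wigner, ← Complex.re_sum, ← Finset.mul_sum, h, h2, Fintype.card_prod, ZMod.card,
    Fintype.card_pi, Finset.prod_const, Finset.card_univ, Fintype.card_fin]
  rw [← Complex.re_ofReal_mul]
  congr 1
  push_cast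
  field_simp

lemma isCPWP_discardSecond (hd : Odd d) (hp : 0 ≤ p) : IsCPWP d 2 (discardSecond d p) := by
  intro k m _ _ ρ hρ
  refine ⟨posSemidef_ampliate_discardSecond hp hρ.1.1, ?_⟩
  rintro ⟨u, v⟩
  rw [wigner_ampliate_discardSecond hd]
  exact mul_nonneg hp (Finset.sum_nonneg fun w _ => hρ.1.2 _)

lemma discardSecond_mem_nonMagicProtocols (hd : Odd d) (hp : 0 ≤ p) (hp1 : p ≤ 1) :
    discardSecond d p ∈ nonMagicProtocols d 2 :=
  ⟨isCPTN_discardSecond hp hp1, isCPWP_discardSecond hd hp⟩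

lemma trace_depolarize_pureState (δ : ℝ) (ψ : UnitVec d) :
    (depolarize d δ (pureState ψ)).trace = 1 := by
  have hd0 : (d : ℂ) ≠ 0 := NeZero.ne _
  rw [depolarize_pureState, Matrix.trace_add, Matrix.trace_smul, Matrix.trace_smul,
    trace_pureState, Matrix.trace_one, ZMod.card, smul_eq_mul, smul_eq_mul]
  push_cast
  field_simp
  ring

lemma outputState_discardSecond (δ : ℝ) (ψ : UnitVec d) :
    outputState δ (discardSecond d p) ψ = (p : ℂ) • depolarize d δ (pureState ψ) := by
  ext a b
  rw [outputState, discardSecond_apply, tensorPow_two, Matrix.smul_apply, smul_eq_mul]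
  congr 1
  simp only [tensorTwo, Matrix.of_apply, Matrix.cons_val_zero, Matrix.cons_val_one]
  rw [← Finset.mul_sum]
  have h := trace_depolarize_pureState δ ψ
  rw [Matrix.trace] at h
  simp only [Matrix.diag_apply] at h
  rw [h, mul_one]

lemma successProb_discardSecond (δ : ℝ) : successProb δ (discardSecond d p) = p := by
  simp only [successProb, outputState_discardSecond, Matrix.trace_smul, trace_depolarize_pureState,
    smul_eq_mul, mul_one, Complex.ofReal_re, integral_const, probReal_univ, one_mul]

lemma outputOverlap_discardSecond (δ : ℝ) :
    outputOverlap δ (discardSecond d p) = p * inputFidelity d δ := by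
  simp only [outputOverlap, inputFidelity, outputState_discardSecond, Matrix.smul_mul,
    Matrix.trace_smul, smul_eq_mul, Complex.re_ofReal_mul, integral_const_mul]

end Discard

end Purification

theorem theorem1 (d : ℕ) [NeZero d] (hd : Odd d) (δ : ℝ) (hδ0 : 0 ≤ δ) (hδ1 : δ ≤ 1) :
    Purification.inputFidelity d δ = 1 - ((d : ℝ) - 1) / d * δ ∧
    (∀ E ∈ Purification.nonMagicProtocols d 2, 0 < Purification.successProb δ E →
      Purification.avgFidelity δ E ≤ Purification.inputFidelity d δ) ∧
    ∀ p : ℝ, 0 < p → p ≤ 1 →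
      IsGreatest (Purification.fidelityValues d δ 2 p) (1 - ((d : ℝ) - 1) / d * δ) ∧
      Purification.maxFidelity d δ 2 p = 1 - ((d : ℝ) - 1) / d * δ := by
  have hd0 : (d : ℝ) ≠ 0 := NeZero.ne _
  have hf : Purification.inputFidelity d δ = 1 - ((d : ℝ) - 1) / d * δ := by
    rw [Purification.inputFidelity_eq]
    field_simp
    ring
  have hle : ∀ E ∈ Purification.nonMagicProtocols d 2, 0 < Purification.successProb δ E →
      Purification.avgFidelity δ E ≤ Purification.inputFidelity d δ := by
    intro E hE hpos
    rw [Purification.avgFidelity, div_le_iff₀ hpos, Purification.inputFidelity_eq]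
    exact Purification.outputOverlap_le hd hδ0 hδ1 hE.2
  refine ⟨hf, hle, fun p hp0 hp1 => ?_⟩
  have hgreatest : IsGreatest (Purification.fidelityValues d δ 2 p)
      (1 - ((d : ℝ) - 1) / d * δ) := by
    constructor
    · refine ⟨Purification.discardSecond d p,
        Purification.discardSecond_mem_nonMagicProtocols hd hp0.le hp1,
        Purification.successProb_discardSecond δ, ?_⟩
      rw [Purification.outputOverlap_discardSecond, hf, ← mul_assoc, one_div,
        inv_mul_cancel₀ hp0.ne', one_mul]
    · rintro f ⟨E, hE, hp, rfl⟩
      have h := hle E hE (hp ▸ hp0)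
      rwa [Purification.avgFidelity, hp, hf, div_eq_inv_mul, ← one_div] at h
  exact ⟨hgreatest, hgreatest.csSup_eq⟩
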